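/- **Setting.** Let $\mathbb H$ be a real separable Hilbert space (of finite or countably infinite dimension) and let $(x,y)\in\mathbb H\times\mathbb R$ be a random pair with $\mathbb E\|x\|^4<\infty$ and $\mathbb E y^2<\infty$. Put $\mathrm{ReLU}(a)=\max\{a,0\}$, $\mathcal R(w)=\mathbb E\big(\mathrm{ReLU}(x^\top w)-y\big)^2$ and $H=\mathbb E[xx^\top]=\sum_{i\ge1}\lambda_i v_iv_i^\top$, with eigenvalues $\lambda_1\ge\lambda_2\ge\dots\ge0$ and orthonormal eigenvectors $v_i$ (both sequences are continued by $0$ when the list is finite). Let $I_{0:k}=\sum_{i\le k}v_iv_i^\top$, $H_{k:\infty}=\sum_{i>k}\lambda_iv_iv_i^\top$ and $\|u\|_A^2=u^\top Au$. *Well-specified noise.* There is $w_*\in\mathbb H$ with $\mathbb E[y\mid x]=\mathrm{ReLU}(x^\top w_*)$, and the additive noise $\epsilon=y-\mathrm{ReLU}(x^\top w_*)$ of variance $\sigma^2:=\mathcal R(w_*)=\mathbb E\epsilon^2$ satisfies $\mathbb E[\epsilon^2\|x\|^2]<\infty$ and $\mathbb E[\epsilon^2xx^\top]=\sigma^2H$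 (for instance, $\mathbb E[\epsilon^2\mid x]=\sigma^2$). Let $\Delta(w)=\mathcal R(w)-\mathcal R(w_*)$ be the excess risk. *Symmetric features.* For all $u,v\in\mathbb H$, $$\mathbb E\big[xx^\top\mathbf 1\{x^\top u>0,\,x^\top v>0\}\big]=\mathbb E\big[xx^\top\mathbf 1\{x^\top u<0,\,x^\top v<0\}\big],$$ $$\mathbb E\big[(x^\top v)^2xx^\top\mathbf 1\{x^\top u>0,\,x^\top v>0\}\big]=\mathbb E\big[(x^\top v)^2xx^\top\mathbf 1\{x^\top u<0,\,x^\top v<0\}\big].$$ *Algorithm.* Let $N>100$ and $N_{\mathrm{eff}}=N/\log_2N$. For i.i.d. copies $(x_t,y_t)_{t=1}^N$ of $(x,y)$, a deterministic start $w_0\in\mathbb H$ and $\gamma_0>0$, GLM-tron computes $$w_t=w_{t-1}-\gamma_t\big(\mathrm{ReLU}(x_t^\top w_{t-1})-y_t\big)x_t,\qquad t=1,\dots,N,$$ where $\gamma_t=\gamma_{t-1}/2$ if $t$ is a multiple of $\lfloor N_{\mathrm{eff}}\rfloor$ and $\gamma_t=\gamma_{t-1}$ otherwise. For $k\ge0$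 let $D_{\mathrm{eff}}(k)=k+N_{\mathrm{eff}}^2\gamma_0^2\sum_{i>k}\lambda_i^2$. **Theorem.** There are absolute constants $C,c>0$ such that the following holds in this setting. (A) Suppose that for some $\alpha>0$ and every positive semidefinite bounded operator $A$, $\mathbb E[xx^\top Axx^\top]\preceq\alpha\,\mathrm{tr}(HA)\,H$, and that $\gamma_0\cdot4\alpha\,\mathrm{tr}(H)<1$. Then $\Delta(w_N)$ is integrable and, for every $k\ge0$, $$\mathbb E\,\Delta(w_N)\le C\left(\Big\|\prod_{t=1}^N\Big(I-\frac{\gamma_t}2H\Big)(w_0-w_*)\Big\|_H^2+\Big(\alpha\|w_0-w_*\|^2_{\frac{1}{N_{\mathrm{eff}}\gamma_0}I_{0:k}+H_{k:\infty}}+\sigma^2\Big)\frac{D_{\mathrm{eff}}(k)}{N_{\mathrm{eff}}}\right).$$ (B) Suppose that for some $\beta>0$ and every positive semidefinite bounded operator $A$, $\mathbb E[xx^\top Axx^\top]-HAH\succeq\beta\,\mathrm{tr}(HA)\,H$, and that $\gamma_0\lambda_1<1$. Let $k^*=\max\{k\ge1:\lambda_k\ge1/(\gamma_0N_{\mathrm{eff}})\}$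 (and $k^*=0$ if there is no such $k$). Then $\Delta(w_N)$ is integrable and $$\mathbb E\,\Delta(w_N)\ge c\left(\Big\|\prod_{t=1}^N\Big(I-\frac{\gamma_t}2H\Big)(w_0-w_*)\Big\|_H^2+\Big(\beta\|w_0-w_*\|^2_{H_{k^*:\infty}}+\sigma^2\Big)\frac{D_{\mathrm{eff}}(k^*)}{N_{\mathrm{eff}}}\right).$$ -/

import Mathlib

open MeasureTheory ProbabilityTheory
open scoped RealInnerProductSpace

universe u v

noncomputable section

namespace GLMTron

/-- The rectified linear unit. -/
def relu (a : ℝ) : ℝ := max a 0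

section Operators

variable {E : Type u} [NormedAddCommGroup E] [InnerProductSpace ℝ E]

/-- The operator `x xᵀ`, that is `z ↦ ⟪x, z⟫ x`. -/
def outer (x : E) : E →L[ℝ] E := InnerProductSpace.rankOne ℝ x x

/-- The squared weighted seminorm `‖u‖²_A = ⟪u, A u⟫`. -/
def wnormSq (A : E →L[ℝ] E) (u : E) : ℝ := ⟪u, A u⟫

/-- The trace `∑ᵢ ⟪bᵢ, T bᵢ⟫` along a Hilbert basis `b` of the space. It is only used for
trace-class operators, for which the value does not depend on the basis. -/
def opTrace [CompleteSpace E] (T : E →L[ℝ] E) : ℝ :=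
  ∑' i : (exists_hilbertBasis ℝ E).choose,
    ⟪(exists_hilbertBasis ℝ E).choose_spec.choose i,
      T ((exists_hilbertBasis ℝ E).choose_spec.choose i)⟫

/-- `H = ∑ᵢ λᵢ vᵢ vᵢᵀ` with non-increasing eigenvalues and orthonormal eigenvectors. Indices start
at `0`, so `lam i` and `v i` are the `(i+1)`-st eigenvalue and eigenvector. If the space (or the
list of eigenvectors) is finite, the sequences are continued by `lam i = 0` and `v i = 0`. -/
structure IsEigenDecomp (H : E →L[ℝ] E) (lam : ℕ → ℝ) (v : ℕ → E) : Prop where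
  antitone : Antitone lam
  nonneg : ∀ i, 0 ≤ lam i
  unit_or_pad : ∀ i, ‖v i‖ = 1 ∨ (v i = 0 ∧ lam i = 0)
  orthogonal : ∀ i j, i ≠ j → ⟪v i, v j⟫ = 0
  hasSum : HasSum (fun i => lam i • outer (v i)) H

/-- `I_{0:k}`, the sum of `vᵢ vᵢᵀ` over the first `k` eigenvectors. -/
def headProj (v : ℕ → E) (k : ℕ) : E →L[ℝ] E := ∑ i ∈ Finset.range k, outer (v i)

/-- `H_{k:∞}`, the sum of `λᵢ vᵢ vᵢᵀ` over all but the first `k` eigenvectors. -/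
def tailOp (lam : ℕ → ℝ) (v : ℕ → E) (k : ℕ) : E →L[ℝ] E :=
  ∑' i : ℕ, lam (k + i) • outer (v (k + i))

end Operators

section StepSize

/-- The effective sample size `N / log₂ N`. -/
def Neff (N : ℕ) : ℝ := (N : ℝ) / Real.logb 2 N

/-- The geometrically decaying stepsize: it is halved at every multiple of `⌊N / log₂ N⌋`. -/
def stepsize (γ₀ : ℝ) (N : ℕ) : ℕ → ℝ
  | 0 => γ₀
  | t + 1 => if (t + 1) % ⌊Neff N⌋₊ = 0 then stepsize γ₀ N t / 2 else stepsize γ₀ N t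

/-- The effective dimension `k + N_eff² γ₀² ∑_{i>k} λᵢ²`. -/
def Deff (lam : ℕ → ℝ) (γ₀ : ℝ) (N k : ℕ) : ℝ :=
  (k : ℝ) + Neff N ^ 2 * γ₀ ^ 2 * ∑' i : ℕ, lam (k + i) ^ 2

/-- The largest `k ≥ 1` whose `k`-th eigenvalue is at least `1 / (γ₀ N_eff)`, and `0` if there is
none. -/
def kStar (lam : ℕ → ℝ) (γ₀ : ℝ) (N : ℕ) : ℕ :=
  sSup {k : ℕ | 1 ≤ k ∧ 1 / (γ₀ * Neff N) ≤ lam (k - 1)}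

end StepSize

section Problem

variable {E : Type u} [NormedAddCommGroup E] [InnerProductSpace ℝ E]

/-- GLM-tron with stepsizes `γ`, started at `w₀` and run on the samples `z 1, z 2, …`, each a pair
of a feature vector and a label. -/
def iterate (γ : ℕ → ℝ) (w₀ : E) (z : ℕ → E × ℝ) : ℕ → E
  | 0 => w₀
  | t + 1 =>
    iterate γ w₀ z t -
      (γ (t + 1) * (relu ⟪(z (t + 1)).1, iterate γ w₀ z t⟫ - (z (t + 1)).2)) • (z (t + 1)).1

/-- `∏_{t=1}^N (I - (γ_t / 2) H)`; the factors commute. -/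
def biasOp (H : E →L[ℝ] E) (γ : ℕ → ℝ) (N : ℕ) : E →L[ℝ] E :=
  ((List.range N).map fun t => (1 : E →L[ℝ] E) - (γ (t + 1) / 2) • H).prod

variable [MeasurableSpace E]

/-- The population risk; `D` is the joint law of the pair (feature, label). -/
def risk (D : Measure (E × ℝ)) (w : E) : ℝ := ∫ z, (relu ⟪z.1, w⟫ - z.2) ^ 2 ∂D

/-- The excess risk over the reference parameter. -/
def excessRisk (D : Measure (E × ℝ)) (wstar w : E) : ℝ := risk D w - risk D wstar

/-- The second moment operator `H = E[x xᵀ]`. -/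
def cov (D : Measure (E × ℝ)) : E →L[ℝ] E := ∫ z, outer z.1 ∂D

/-- Well-specified labels: `E[y | x] = relu (xᵀ w*)`, and the additive noise
`ε = y - relu (xᵀ w*)` has finite variance `σ² = risk D wstar` with `E[ε² x xᵀ] = σ² H`. -/
structure WellSpecified (D : Measure (E × ℝ)) (wstar : E) : Prop where
  memLp_label : MemLp (fun z : E × ℝ => z.2) 2 D
  condExp_label : D[fun z : E × ℝ => z.2 | MeasurableSpace.comap Prod.fst inferInstance]
    =ᵐ[D] fun z => relu ⟪z.1, wstar⟫
  integrable_noise :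
    Integrable (fun z : E × ℝ => (z.2 - relu ⟪z.1, wstar⟫) ^ 2 * ‖z.1‖ ^ 2) D
  noise_cov : ∫ z, (z.2 - relu ⟪z.1, wstar⟫) ^ 2 • outer z.1 ∂D = risk D wstar • cov D

/-- Second and fourth moments of the features, restricted to a sector, are invariant under
changing the sign of the sector. -/
structure SymmetricFeatures (D : Measure (E × ℝ)) : Prop where
  second : ∀ u v : E,
    ∫ z in {z : E × ℝ | 0 < ⟪z.1, u⟫ ∧ 0 < ⟪z.1, v⟫}, outer z.1 ∂D =
      ∫ z in {z : E × ℝ | ⟪z.1, u⟫ < 0 ∧ ⟪z.1, v⟫ < 0}, outer z.1 ∂D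
  fourth : ∀ u v : E,
    ∫ z in {z : E × ℝ | 0 < ⟪z.1, u⟫ ∧ 0 < ⟪z.1, v⟫}, ⟪z.1, v⟫ ^ 2 • outer z.1 ∂D =
      ∫ z in {z : E × ℝ | ⟪z.1, u⟫ < 0 ∧ ⟪z.1, v⟫ < 0}, ⟪z.1, v⟫ ^ 2 • outer z.1 ∂D

/-- Finite fourth moment of the features, `E ‖x‖⁴ < ∞`. -/
def FourthMoment (D : Measure (E × ℝ)) : Prop := MemLp (fun z : E × ℝ => z.1) 4 D

/-- `E[x xᵀ A x xᵀ] ≼ α tr(H A) H` in the Loewner order, for all positive semidefinite `A`. -/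
def UpperHypercontractive [CompleteSpace E] (D : Measure (E × ℝ)) (α : ℝ) : Prop :=
  ∀ A : E →L[ℝ] E, A.IsPositive →
    ∫ z, outer z.1 * A * outer z.1 ∂D ≤ (α * opTrace (cov D * A)) • cov D

/-- `E[x xᵀ A x xᵀ] - H A H ≽ β tr(H A) H` in the Loewner order, for all positive semidefinite
`A`. -/
def LowerHypercontractive [CompleteSpace E] (D : Measure (E × ℝ)) (β : ℝ) : Prop :=
  ∀ A : E →L[ℝ] E, A.IsPositive →
    (β * opTrace (cov D * A)) • cov D ≤
      ∫ z, outer z.1 * A * outer z.1 ∂D - cov D * A * cov D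

/-- The random pairs `Z 1, …, Z N` are independent with common law `D`. -/
structure IsSample {Ω : Type v} [MeasurableSpace Ω] (P : Measure Ω) (D : Measure (E × ℝ)) (N : ℕ)
    (Z : ℕ → Ω → E × ℝ) : Prop where
  indep : iIndepFun (fun t : Finset.Icc 1 N => Z t) P
  law : ∀ t ∈ Finset.Icc 1 N, HasLaw (Z t) D P

end Problem

end GLMTron

end

set_option linter.unusedSectionVars false

/-! The sector symmetry makes a ReLU neuron behave, in second moment, like a linear one. The squared
difference `(relu a - relu b) ^ 2` is a signed sum of quadrant indicators times squares
(`relu_sub_sq`), and the symmetry says that each such term keeps its mean when both directions are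
negated. Averaging over `±` gives, for the weights `1` and `⟪x, h⟫ ^ 2`, that the ReLU quantity lies
between `1/4` and `1/2` of its linear counterpart (`integral_relu_sub_sq_bounds`); moreover
`E[relu(xᵀw) x] = H w / 2`. Hence the excess risk is comparable to `‖w - w*‖²_H`, and the mean drift
of one step is that of SGD for least squares with half the stepsize.

Projected on an eigenvector, one step therefore gives a scalar recursion for `a t i = E⟪w_t - w*, e
i⟫²`. The directions are coupled only through `S t = ∑ λ_i a t i`: the moment assumptions, tested on
rank-one operators, bound the fourth-moment term by a multiple of `λ_i S t` (plus, from below, `λ_i²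
a t i / 4`, which completes the square `(1 - γλ_i/2)²`). The rest is deterministic.

Upper bound (`upper_of_recursion`): the trace condition lets `S` be absorbed into its own bound,
first on average over the initial phase and then uniformly from a good time on. Unrolling leaves the
bias plus a noise of order `1 / N_eff` in each head direction (old noise is forgotten, recent noise
has small stepsize) and `N_eff γ₀² λ_i²` in each tail direction (nothing needs to be forgotten).
These sum to `D_eff / N_eff`.

Lower bound (`lower_of_recursion`): tail directions contract by at most a constant factor, so `S`
stays above a multiple of its initial tail. For each head direction, one phase has `γλ_i` between `1
/ N_eff` and `2 / N_eff`, and the noise injected in that phase alone survives and suffices; for tail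
directions the initial phase does. -/

namespace GLMTron

/-! ### Geometry of the stepsize schedule. -/

section StepSizeFacts

/-- The number of steps between two halvings of the stepsize. -/
noncomputable def phaseLen (N : ℕ) : ℕ := ⌊Neff N⌋₊

lemma two_le_logb {N : ℕ} (hN : 100 < N) : 2 ≤ Real.logb 2 N := by
  have hN' : (100 : ℝ) < N := by exact_mod_cast hN
  rw [Real.le_logb_iff_rpow_le (by norm_num) (by linarith)]
  norm_num
  linarith

/-- The tangent line of `log` at `8` suffices. The lemma guarantees that a phase has at least two
steps. -/
lemma logb_le_half {N : ℕ} (hN : 100 < N) : Real.logb 2 N ≤ (N : ℝ) / 2 := by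
  have hN' : (100 : ℝ) < N := by exact_mod_cast hN
  have h2 : (0.69 : ℝ) < Real.log 2 := by linarith [Real.log_two_gt_d9]
  have h2' : Real.log 2 < 0.7 := by linarith [Real.log_two_lt_d9]
  have h8 : Real.log 8 = 3 * Real.log 2 := by
    rw [show (8 : ℝ) = 2 ^ 3 by norm_num, Real.log_pow]; norm_num
  have h1 : Real.log N ≤ (N : ℝ) / 8 - 1 + 3 * Real.log 2 := by
    have h := Real.log_le_sub_one_of_pos (show (0 : ℝ) < N / 8 by positivity)
    rw [Real.log_div (by positivity) (by norm_num), h8] at h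
    linarith
  rw [Real.logb, div_le_iff₀ (by linarith)]
  nlinarith

lemma two_le_Neff {N : ℕ} (hN : 100 < N) : 2 ≤ Neff N := by
  have h1 := two_le_logb hN
  have h2 := logb_le_half hN
  rw [Neff, le_div_iff₀ (by linarith)]
  linarith

lemma two_le_phaseLen {N : ℕ} (hN : 100 < N) : 2 ≤ phaseLen N :=
  Nat.le_floor (by exact_mod_cast two_le_Neff hN)

lemma phaseLen_le {N : ℕ} (hN : 100 < N) : (phaseLen N : ℝ) ≤ Neff N :=
  Nat.floor_le (by linarith [two_le_Neff hN])

lemma Neff_le_two_mul {N : ℕ} (hN : 100 < N) : Neff N ≤ 2 * (phaseLen N : ℝ) := by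
  have h := Nat.lt_floor_add_one (Neff N)
  have h2 : (2 : ℝ) ≤ phaseLen N := by exact_mod_cast two_le_phaseLen hN
  unfold phaseLen at h2 ⊢
  linarith

/-- The initial phase contains only `phaseLen N - 1` updates, because the stepsize is halved before
it is used at step `phaseLen N`. This count is still of order `Neff N`. -/
lemma Neff_le_four_mul {N : ℕ} (hN : 100 < N) : Neff N ≤ 4 * ((phaseLen N : ℝ) - 1) := by
  have h2 : (2 : ℝ) ≤ phaseLen N := by exact_mod_cast two_le_phaseLen hN
  have h := Neff_le_two_mul hN
  linarith

lemma phaseLen_mul_logb_le {N : ℕ} (hN : 100 < N) :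
    (phaseLen N : ℝ) * Real.logb 2 N ≤ N := by
  have h1 := two_le_logb hN
  have h := phaseLen_le hN
  rwa [Neff, le_div_iff₀ (by linarith)] at h

lemma phaseLen_le_self {N : ℕ} (hN : 100 < N) : (phaseLen N : ℝ) ≤ N := by
  have h1 := two_le_logb hN
  have h := phaseLen_mul_logb_le hN
  have h0 : (0 : ℝ) ≤ phaseLen N := by positivity
  nlinarith

lemma stepsize_eq {γ₀ : ℝ} {N : ℕ} (hN : 100 < N) (t : ℕ) :
    stepsize γ₀ N t = γ₀ / 2 ^ (t / phaseLen N) := by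
  have hK := two_le_phaseLen hN
  induction t with
  | zero => simp [stepsize]
  | succ t ih =>
    rw [stepsize, Nat.succ_div, ih]
    change (if (t + 1) % phaseLen N = 0 then _ else _) = _
    by_cases h : phaseLen N ∣ t + 1
    · rw [if_pos (Nat.mod_eq_zero_of_dvd h), if_pos h, pow_succ, div_div]
    · rw [if_neg (fun h' => h (Nat.dvd_of_mod_eq_zero h')), if_neg h, add_zero]

variable {γ₀ : ℝ} {N : ℕ}

lemma stepsize_pos (hγ : 0 < γ₀) (hN : 100 < N) (t : ℕ) : 0 < stepsize γ₀ N t := by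
  rw [stepsize_eq hN]; positivity

lemma stepsize_le (hγ : 0 < γ₀) (hN : 100 < N) (t : ℕ) : stepsize γ₀ N t ≤ γ₀ := by
  rw [stepsize_eq hN]
  exact div_le_self hγ.le (one_le_pow₀ (by norm_num))

lemma stepsize_of_phase (hN : 100 < N) {q t : ℕ} (h1 : q * phaseLen N ≤ t)
    (h2 : t < (q + 1) * phaseLen N) : stepsize γ₀ N t = γ₀ / 2 ^ q := by
  rw [stepsize_eq hN, Nat.div_eq_of_lt_le h1 h2]

/-- The potential `γ_t (2K - t mod K)`, with `K` the phase length, bounds all future stepsizes: what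
is left of the current phase plus the geometric series of the later ones. Each step lowers it by at
least the stepsize used. -/
lemma sum_stepsize_potential (hγ : 0 < γ₀) (hN : 100 < N) {t n : ℕ} (h : t ≤ n) :
    ∑ s ∈ Finset.Ico t n, stepsize γ₀ N (s + 1) ≤
      stepsize γ₀ N t * (2 * phaseLen N - (t % phaseLen N : ℕ)) -
        stepsize γ₀ N n * (2 * phaseLen N - (n % phaseLen N : ℕ)) := by
  have hK := two_le_phaseLen hN
  induction n, h using Nat.le_induction with
  | base => simp
  | succ n hn ih =>
    rw [Finset.sum_Ico_succ_top hn]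
    have hpos := stepsize_pos hγ hN n
    refine le_trans (add_le_add_left ih _) ?_
    have key : stepsize γ₀ N (n + 1) + stepsize γ₀ N (n + 1) *
        (2 * phaseLen N - ((n + 1) % phaseLen N : ℕ)) ≤
        stepsize γ₀ N n * (2 * phaseLen N - (n % phaseLen N : ℕ)) := by
      have hst : stepsize γ₀ N (n + 1) =
        if (n + 1) % phaseLen N = 0 then stepsize γ₀ N n / 2 else stepsize γ₀ N n := rfl
      rw [hst]
      by_cases h0 : (n + 1) % phaseLen N = 0
      · have hlt : ((n % phaseLen N : ℕ) : ℝ) + 1 ≤ phaseLen N := by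
          exact_mod_cast Nat.mod_lt n (by omega)
        rw [if_pos h0, h0]
        push_cast
        nlinarith
      · rw [if_neg h0]
        have hm : (n + 1) % phaseLen N = n % phaseLen N + 1 := by
          rw [Nat.add_mod] at h0 ⊢
          rw [Nat.mod_eq_of_lt (show 1 < phaseLen N by omega)] at h0 ⊢
          have hlt := Nat.mod_lt n (show phaseLen N > 0 by omega)
          rcases Nat.lt_or_ge (n % phaseLen N + 1) (phaseLen N) with h | h
          · exact Nat.mod_eq_of_lt h
          · exact absurd (by rw [show n % phaseLen N + 1 = phaseLen N by omega, Nat.mod_self]) h0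
        rw [hm]
        push_cast
        nlinarith
    linarith

lemma sum_stepsize_le (hγ : 0 < γ₀) (hN : 100 < N) (t n : ℕ) :
    ∑ s ∈ Finset.Ico t n, stepsize γ₀ N (s + 1) ≤ 2 * phaseLen N * stepsize γ₀ N t := by
  have hK := two_le_phaseLen hN
  have hp := stepsize_pos hγ hN
  rcases le_total t n with h | h
  · refine (sum_stepsize_potential hγ hN h).trans ?_
    have hlt : ((n % phaseLen N : ℕ) : ℝ) ≤ phaseLen N := by
      exact_mod_cast (Nat.mod_lt n (by omega)).le
    have h1 : 0 ≤ stepsize γ₀ N n * (2 * phaseLen N - (n % phaseLen N : ℕ)) :=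
      mul_nonneg (hp n).le (by have : (0 : ℝ) ≤ phaseLen N := by positivity
                               linarith)
    have h2 : 0 ≤ stepsize γ₀ N t * ((t % phaseLen N : ℕ) : ℝ) :=
      mul_nonneg (hp t).le (by positivity)
    linarith
  · rw [Finset.Ico_eq_empty_of_le h, Finset.sum_empty]
    have := hp t
    positivity

/-- The remaining stepsizes dominate one phase at the current stepsize, unless the current
stepsize is already of order `γ₀ / N`. -/
lemma phaseLen_mul_stepsize_le (hγ : 0 < γ₀) (hN : 100 < N) {lam : ℝ} (hl : 0 ≤ lam)
    (hγl : γ₀ * lam ≤ 1 / 4) (t : ℕ) :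
    phaseLen N * stepsize γ₀ N t * lam ≤
      2 * (lam * ∑ s ∈ Finset.Ico t N, stepsize γ₀ N (s + 1)) + 1 := by
  have hK := two_le_phaseLen hN
  have hp := stepsize_pos hγ hN
  have hsum : 0 ≤ ∑ s ∈ Finset.Ico t N, stepsize γ₀ N (s + 1) :=
    Finset.sum_nonneg fun s _ => (hp _).le
  set K := phaseLen N with hKdef
  set q := t / K with hq
  have htq : t < (q + 1) * K := by
    have := Nat.lt_div_mul_add (a := t) (show 0 < K by omega)
    rw [← hq] at this
    linarith
  have hst : stepsize γ₀ N t = γ₀ / 2 ^ q := stepsize_eq hN t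
  -- Without a complete next phase, `q + 2 ≥ log₂ N`, so the stepsize is at most `4γ₀ / N` and the
  -- summand `1` pays. Otherwise the next phase alone contributes half of `K γ_t`.
  rcases Nat.lt_or_ge N ((q + 2) * K) with h | h
  · have hN0 : (0 : ℝ) < N := by exact_mod_cast (by omega : 0 < N)
    have h1 : Real.logb 2 N ≤ (q + 2 : ℕ) := by
      have h2 := phaseLen_mul_logb_le hN
      have h3 : (N : ℝ) < ((q + 2 : ℕ) : ℝ) * K := by exact_mod_cast h
      have hK0 : (0 : ℝ) < K := by exact_mod_cast (by omega : 0 < K)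
      nlinarith
    rw [Real.logb_le_iff_le_rpow (by norm_num) hN0, Real.rpow_natCast] at h1
    have h4 : stepsize γ₀ N t ≤ 4 * γ₀ / N := by
      rw [hst, div_le_div_iff₀ (by positivity) hN0]
      rw [pow_add] at h1
      nlinarith
    have h5 : (K : ℝ) * (4 * γ₀ / N) ≤ 4 * γ₀ := by
      have := phaseLen_le_self hN
      rw [mul_div_assoc', div_le_iff₀ hN0]
      nlinarith
    have h6 : (K : ℝ) * stepsize γ₀ N t * lam ≤ 4 * γ₀ * lam :=
      mul_le_mul_of_nonneg_right
        ((mul_le_mul_of_nonneg_left h4 (by positivity)).trans h5) hl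
    have := mul_nonneg hl hsum
    linarith
  -- The shift by one is due to the summand being the stepsize at `s + 1`.
  · have hsub : Finset.Ico ((q + 1) * K - 1) ((q + 2) * K - 1) ⊆ Finset.Ico t N := by
      apply Finset.Ico_subset_Ico <;> omega
    have h1 : ∑ s ∈ Finset.Ico ((q + 1) * K - 1) ((q + 2) * K - 1), stepsize γ₀ N (s + 1) =
        K * (γ₀ / 2 ^ (q + 1)) := by
      rw [Finset.sum_congr rfl (g := fun _ => γ₀ / 2 ^ (q + 1)), Finset.sum_const,
        Nat.card_Ico, nsmul_eq_mul]
      · congr 2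
        have : (q + 2) * K = (q + 1) * K + K := by ring
        have : 0 < (q + 1) * K := by positivity
        omega
      · intro s hs
        rw [Finset.mem_Ico] at hs
        have : 0 < (q + 1) * K := by positivity
        have h' : (q + 1 + 1) * K = (q + 2) * K := rfl
        exact stepsize_of_phase hN (by rw [← hKdef]; omega) (by rw [← hKdef, h']; omega)
    have h2 := Finset.sum_le_sum_of_subset_of_nonneg hsub
      (f := fun s => stepsize γ₀ N (s + 1)) (fun s _ _ => (hp _).le)
    rw [h1] at h2
    have h3 : (K : ℝ) * (γ₀ / 2 ^ (q + 1)) = K * stepsize γ₀ N t / 2 := by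
      rw [hst, pow_succ]; field_simp
    rw [h3] at h2
    nlinarith

end StepSizeFacts

/-! ### Scalar recursions, products and exponential sums. -/

section Sequences

/-- Packages coordinatewise bounds that have one form on the head and another on the tail, so that
they can be summed in one comparison. -/
lemma hasSum_head_tail {f g : ℕ → ℝ} (k : ℕ) (hg : Summable fun i => g (k + i)) :
    HasSum (fun i => if i < k then f i else g i)
      (∑ i ∈ Finset.range k, f i + ∑' i, g (k + i)) := by
  rw [← Finset.sum_congr rfl (fun i hi => if_pos (Finset.mem_range.1 hi)), add_comm]
  refine (hasSum_nat_add_iff (f := fun i => if i < k then f i else g i) k).1 ?_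
  simpa [add_comm] using hg.hasSum

lemma sum_le_of_contraction {b c : ℕ → ℝ} {p : ℝ} {M : ℕ} (hb : ∀ t, 0 ≤ b t)
    (h : ∀ t < M, b (t + 1) ≤ (1 - p) * b t + c t) :
    p * ∑ t ∈ Finset.range M, b t ≤ b 0 + ∑ t ∈ Finset.range M, c t := by
  have key : ∀ n ≤ M, b n + p * ∑ t ∈ Finset.range n, b t ≤ b 0 + ∑ t ∈ Finset.range n, c t := by
    intro n
    induction n with
    | zero => simp
    | succ n ih =>
      intro hn
      rw [Finset.sum_range_succ, Finset.sum_range_succ]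
      linarith [ih (by omega), h n (by omega)]
  linarith [key M le_rfl, hb M]

/-- The positive part of `b t - b 0` satisfies the same recursion and starts from zero. For small
`p` this replaces the cost `b 0` of `sum_le_of_contraction` by the smaller `M * p * b 0`, as needed
in tail directions. -/
lemma sum_le_of_contraction_of_start {b c : ℕ → ℝ} {p : ℝ} {M : ℕ} (hp : 0 ≤ p) (hp1 : p ≤ 1)
    (hb : 0 ≤ b 0) (hc : ∀ t, 0 ≤ c t)
    (h : ∀ t < M, b (t + 1) ≤ (1 - p) * b t + c t) :
    p * ∑ t ∈ Finset.range M, b t ≤ M * (p * b 0) + ∑ t ∈ Finset.range M, c t := by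
  have h1 := sum_le_of_contraction (b := fun t => max (b t - b 0) 0) (c := c) (p := p) (M := M)
    (fun t => le_max_right _ _) (fun t ht => by
      have h2 : 0 ≤ (1 - p) * max (b t - b 0) 0 :=
        mul_nonneg (by linarith) (le_max_right _ _)
      have h3 : (1 - p) * (b t - b 0) ≤ (1 - p) * max (b t - b 0) 0 :=
        mul_le_mul_of_nonneg_left (le_max_left _ _) (by linarith)
      have h4 := mul_nonneg hp hb
      refine max_le ?_ ?_
      · linarith [h t ht]
      · linarith [hc t])
  simp only [sub_self, max_self, zero_add] at h1
  have h2 : ∑ t ∈ Finset.range M, b t ≤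
      ∑ t ∈ Finset.range M, (b 0 + max (b t - b 0) 0) :=
    Finset.sum_le_sum fun t _ => by linarith [le_max_left (b t - b 0) 0]
  rw [Finset.sum_add_distrib, Finset.sum_const, Finset.card_range, nsmul_eq_mul] at h2
  have h3 := mul_le_mul_of_nonneg_left h2 hp
  linarith

lemma le_unroll {b c p : ℕ → ℝ} {N : ℕ} (hp : ∀ t, 0 ≤ p t)
    (h : ∀ t < N, b (t + 1) ≤ p t * b t + c t) :
    b N ≤ (∏ s ∈ Finset.range N, p s) * b 0 +
      ∑ t ∈ Finset.range N, (∏ s ∈ Finset.Ico (t + 1) N, p s) * c t := by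
  induction N with
  | zero => simp
  | succ n ih =>
    refine (h n (by omega)).trans ?_
    have h1 := mul_le_mul_of_nonneg_left (ih fun t ht => h t (by omega)) (hp n)
    rw [Finset.prod_range_succ, Finset.sum_range_succ]
    have h2 : ∑ t ∈ Finset.range n, (∏ s ∈ Finset.Ico (t + 1) (n + 1), p s) * c t =
        p n * ∑ t ∈ Finset.range n, (∏ s ∈ Finset.Ico (t + 1) n, p s) * c t := by
      rw [Finset.mul_sum]
      refine Finset.sum_congr rfl fun t ht => ?_
      rw [Finset.prod_Ico_succ_top (by have := Finset.mem_range.1 ht; omega)]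
      ring
    rw [h2, Finset.Ico_self, Finset.prod_empty]
    linarith

lemma unroll_le {b c p : ℕ → ℝ} {N : ℕ} (hp : ∀ t, 0 ≤ p t)
    (h : ∀ t < N, p t * b t + c t ≤ b (t + 1)) :
    (∏ s ∈ Finset.range N, p s) * b 0 +
      ∑ t ∈ Finset.range N, (∏ s ∈ Finset.Ico (t + 1) N, p s) * c t ≤ b N := by
  have h1 := le_unroll (b := fun t => - b t) (c := fun t => - c t) (p := p) (N := N) hp
    (fun t ht => by linarith [h t ht])
  simp only [mul_neg, Finset.sum_neg_distrib] at h1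
  linarith

/-- A Riemann sum of `exp (-r / 2)` along the remaining sums of `g`. -/
lemma sum_mul_exp_le {g : ℕ → ℝ} {N : ℕ} (hg : ∀ t, 0 ≤ g t) (hg1 : ∀ t, g t ≤ 1) :
    ∑ t ∈ Finset.range N, g t * Real.exp (-(∑ s ∈ Finset.Ico (t + 1) N, g s) / 2) ≤ 4 := by
  set E : ℕ → ℝ := fun t => Real.exp (-(∑ s ∈ Finset.Ico t N, g s) / 2) with hE
  -- Each term is dominated by a telescoping increment because `exp (-g/2) ≤ 1 - g/4` on `[0, 1]`.
  have hstep : ∀ t ∈ Finset.range N, g t * E (t + 1) ≤ 4 * (E (t + 1) - E t) := by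
    intro t ht
    have ht := Finset.mem_range.1 ht
    have h1 : E t = Real.exp (-(g t / 2)) * E (t + 1) := by
      simp only [hE]
      rw [Finset.sum_eq_sum_Ico_succ_bot ht, ← Real.exp_add]
      congr 1
      ring
    have h2 : Real.exp (-(g t / 2)) ≤ 1 - g t / 4 := by
      have h3 := Real.add_one_le_exp (g t / 2)
      rw [Real.exp_neg, inv_le_comm₀ (Real.exp_pos _) (by linarith [hg1 t])]
      refine le_trans ?_ h3
      rw [inv_le_iff_one_le_mul₀ (by linarith [hg1 t])]
      nlinarith [hg t, hg1 t]
    have h3 : 0 < E (t + 1) := Real.exp_pos _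
    rw [h1]
    nlinarith
  calc ∑ t ∈ Finset.range N, g t * E (t + 1)
      ≤ ∑ t ∈ Finset.range N, 4 * (E (t + 1) - E t) := Finset.sum_le_sum hstep
    _ = 4 * (E N - E 0) := by rw [← Finset.mul_sum, Finset.sum_range_sub]
    _ ≤ 4 := by
      have h1 : E N = 1 := by simp [hE]
      have h2 : 0 < E 0 := Real.exp_pos _
      linarith

lemma prod_one_sub_le_exp {p : ℕ → ℝ} (s : Finset ℕ) (hp : ∀ t, p t ≤ 1) :
    ∏ t ∈ s, (1 - p t) ≤ Real.exp (-∑ t ∈ s, p t) := by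
  rw [← Finset.sum_neg_distrib, Real.exp_sum]
  exact Finset.prod_le_prod (fun t _ => by linarith [hp t]) fun t _ => Real.one_sub_le_exp_neg _

lemma exp_le_prod_one_sub {p : ℕ → ℝ} (s : Finset ℕ) (hp : ∀ t, 0 ≤ p t) (hp1 : ∀ t, p t ≤ 1 / 2) :
    Real.exp (-(2 * ∑ t ∈ s, p t)) ≤ ∏ t ∈ s, (1 - p t) := by
  rw [Finset.mul_sum, ← Finset.sum_neg_distrib, Real.exp_sum]
  refine Finset.prod_le_prod (fun t _ => (Real.exp_pos _).le) fun t _ => ?_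
  have h3 := Real.add_one_le_exp (2 * p t)
  rw [Real.exp_neg, inv_le_comm₀ (Real.exp_pos _) (by linarith [hp1 t])]
  refine le_trans ?_ h3
  rw [inv_le_iff_one_le_mul₀ (by linarith [hp1 t])]
  nlinarith [hp t, hp1 t]

end Sequences

/-! ### The deterministic upper bound. -/

section UpperRecursion

variable {lam : ℕ → ℝ} {a : ℕ → ℕ → ℝ} {γ₀ α σ2 : ℝ} {N : ℕ}

/-- Controls `S` on average over the initial phase, where the stepsize is constant. Head directions
pay `a 0 i / γ₀`, tail directions `M λ_i a 0 i`; the feedback of `S` into itself has coefficient at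
most `1/8` by the trace condition and is absorbed. -/
lemma recursion_average (hN : 100 < N) (hγ : 0 < γ₀) (hα : 0 < α) (hσ : 0 ≤ σ2)
    (hlam : ∀ i, 0 ≤ lam i) (hsum : Summable lam) (hγl : ∀ i, γ₀ * lam i ≤ 1 / 4)
    (htr : γ₀ * (4 * α * ∑' i, lam i) ≤ 1) (ha : ∀ t i, 0 ≤ a t i)
    (hS : ∀ t ≤ N, Summable fun i => lam i * a t i)
    (hrec : ∀ t < N, ∀ i, a (t + 1) i ≤ (1 - stepsize γ₀ N (t + 1) * lam i) * a t i +
      stepsize γ₀ N (t + 1) ^ 2 * lam i * (α / 2 * (∑' j, lam j * a t j) + σ2)) (k : ℕ) :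
    α * ∑ t ∈ Finset.range (phaseLen N - 1), ∑' i, lam i * a t i ≤
      2 * α * ((∑ i ∈ Finset.range k, a 0 i) / γ₀ +
        (phaseLen N - 1 : ℕ) * ∑' i, lam (k + i) * a 0 (k + i)) + (phaseLen N - 1 : ℕ) * σ2 := by
  set M := phaseLen N - 1 with hM
  have hMN : M ≤ N := by
    have : phaseLen N ≤ N := by exact_mod_cast phaseLen_le_self hN
    omega
  set S : ℕ → ℝ := fun t => ∑' i, lam i * a t i with hSdef
  have hS0 : ∀ t, 0 ≤ S t := fun t => tsum_nonneg fun i => mul_nonneg (hlam i) (ha t i)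
  have hstep : ∀ t < M, stepsize γ₀ N (t + 1) = γ₀ := fun t ht => by
    rw [stepsize_of_phase hN (q := 0) (by simp) (by omega)]; simp
  set V : ℝ := ∑ t ∈ Finset.range M, (α / 2 * S t + σ2) with hV
  have hi : ∀ i, ∑ t ∈ Finset.range M, lam i * a t i ≤
      (if i < k then a 0 i / γ₀ else M * (lam i * a 0 i)) + γ₀ * lam i * V := by
    intro i
    have hr : ∀ t < M, a (t + 1) i ≤ (1 - γ₀ * lam i) * a t i +
        γ₀ ^ 2 * lam i * (α / 2 * S t + σ2) := by
      intro t ht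
      have := hrec t (by omega) i
      rwa [hstep t ht] at this
    have hp : 0 ≤ γ₀ * lam i := mul_nonneg hγ.le (hlam i)
    have hc : ∑ t ∈ Finset.range M, γ₀ ^ 2 * lam i * (α / 2 * S t + σ2) =
      γ₀ * (γ₀ * lam i * V) := by rw [← Finset.mul_sum]; ring
    rw [← Finset.mul_sum]
    split_ifs with hik
    · have h := sum_le_of_contraction (fun t => ha t i) hr
      rw [hc] at h
      refine le_of_mul_le_mul_left ?_ hγ
      rw [mul_add, mul_div_cancel₀ _ hγ.ne']
      linarith
    · have hc0 : ∀ t, 0 ≤ γ₀ ^ 2 * lam i * (α / 2 * S t + σ2) := fun t => by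
        have := hS0 t
        have := hlam i
        positivity
      have h := sum_le_of_contraction_of_start (b := fun t => a t i) hp (by linarith [hγl i])
        (ha 0 i) hc0 hr
      rw [hc] at h
      refine le_of_mul_le_mul_left ?_ hγ
      linarith
  have htail : Summable fun i => (M : ℝ) * (lam (k + i) * a 0 (k + i)) := by
    have := ((summable_nat_add_iff k).2 (hS 0 (by omega))).mul_left (M : ℝ)
    simpa [add_comm] using this
  have hht := hasSum_head_tail (f := fun i => a 0 i / γ₀)
    (g := fun i => (M : ℝ) * (lam i * a 0 i)) k htail
  have hS' : ∀ t ∈ Finset.range M, Summable fun i => lam i * a t i := fun t ht =>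
    hS t (by have := Finset.mem_range.1 ht; omega)
  have h1 : ∑ t ∈ Finset.range M, S t ≤
      (∑ i ∈ Finset.range k, a 0 i / γ₀ + ∑' i, (M : ℝ) * (lam (k + i) * a 0 (k + i))) +
        γ₀ * (∑' i, lam i) * V := by
    simp only [hSdef]
    rw [← Summable.tsum_finsetSum hS']
    have h3 : HasSum (fun i => γ₀ * lam i * V) (γ₀ * (∑' i, lam i) * V) :=
      (hsum.hasSum.mul_left γ₀).mul_right V
    rw [← (hht.add h3).tsum_eq]
    exact Summable.tsum_le_tsum hi (summable_sum hS') (hht.add h3).summable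
  rw [← Finset.sum_div, tsum_mul_left] at h1
  set SS := ∑ t ∈ Finset.range M, S t with hSS
  have hVeq : V = α / 2 * SS + M * σ2 := by
    rw [hV, Finset.sum_add_distrib, ← Finset.mul_sum, Finset.sum_const, Finset.card_range,
      nsmul_eq_mul]
  have hV0 : 0 ≤ V := by
    have : 0 ≤ SS := Finset.sum_nonneg fun t _ => hS0 t
    rw [hVeq]; positivity
  have hSS0 : 0 ≤ SS := Finset.sum_nonneg fun t _ => hS0 t
  have h2 : α * (γ₀ * (∑' i, lam i) * V) ≤ 1 / 4 * V := by nlinarith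
  have h3 := mul_le_mul_of_nonneg_left h1 hα.le
  have h4 : 0 ≤ α * SS := by positivity
  have h5 : (0 : ℝ) ≤ M * σ2 := by positivity
  rw [mul_add] at h3
  nlinarith

/-- A bootstrap: if the driving term has stayed below `W`, each coordinate exceeds its value at `t₀`
by at most `γ₀ W`. Summed against `λ`, this raises `α S` by at most `W / 4`, which closes the
induction. -/
lemma recursion_sup (hN : 100 < N) (hγ : 0 < γ₀) (hα : 0 < α) (hσ : 0 ≤ σ2)
    (hlam : ∀ i, 0 ≤ lam i) (hsum : Summable lam) (hγl : ∀ i, γ₀ * lam i ≤ 1 / 4)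
    (htr : γ₀ * (4 * α * ∑' i, lam i) ≤ 1) (ha : ∀ t i, 0 ≤ a t i)
    (hS : ∀ t ≤ N, Summable fun i => lam i * a t i)
    (hrec : ∀ t < N, ∀ i, a (t + 1) i ≤ (1 - stepsize γ₀ N (t + 1) * lam i) * a t i +
      stepsize γ₀ N (t + 1) ^ 2 * lam i * (α / 2 * (∑' j, lam j * a t j) + σ2))
    {t₀ t : ℕ} (ht₀ : t₀ ≤ t) (ht : t ≤ N) :
    α * ∑' i, lam i * a t i ≤ 2 * (α * ∑' i, lam i * a t₀ i) + σ2 := by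
  set S : ℕ → ℝ := fun t => ∑' i, lam i * a t i with hSdef
  have hS0 : ∀ t, 0 ≤ S t := fun t => tsum_nonneg fun i => mul_nonneg (hlam i) (ha t i)
  -- `W` is the driving term `α/2 * S t + σ2` evaluated at the bound to be proved.
  set W : ℝ := (2 * (α * S t₀) + σ2) / 2 + σ2 with hW
  have hW0 : 0 ≤ W := by have := hS0 t₀; positivity
  have key : ∀ t, t₀ ≤ t → t ≤ N → (∀ i, a t i ≤ a t₀ i + γ₀ * W) ∧
      α * S t ≤ 2 * (α * S t₀) + σ2 := by
    intro t ht
    induction t, ht using Nat.le_induction with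
    | base =>
      intro _
      refine ⟨fun i => ?_, ?_⟩
      · have := mul_nonneg hγ.le hW0; linarith
      · have := mul_nonneg hα.le (hS0 t₀); linarith
    | succ t ht ih =>
      intro htN
      obtain ⟨ih1, ih2⟩ := ih (by omega)
      have hi : ∀ i, a (t + 1) i ≤ a t₀ i + γ₀ * W := by
        intro i
        have h1 := hrec t (by omega) i
        have hg := stepsize_pos hγ hN (t + 1)
        have hg' := stepsize_le hγ hN (t + 1)
        set g := stepsize γ₀ N (t + 1)
        have hgl : g * lam i ≤ 1 := by
          have := mul_le_mul_of_nonneg_right hg' (hlam i)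
          linarith [hγl i]
        have hgl0 : 0 ≤ g * lam i := mul_nonneg hg.le (hlam i)
        have h2 : (1 - g * lam i) * a t i ≤ (1 - g * lam i) * (a t₀ i + γ₀ * W) :=
          mul_le_mul_of_nonneg_left (ih1 i) (by linarith)
        have h3 : g ^ 2 * lam i * (α / 2 * S t + σ2) ≤ g ^ 2 * lam i * W :=
          mul_le_mul_of_nonneg_left (by rw [hW]; linarith)
            (mul_nonneg (sq_nonneg _) (hlam i))
        have h4 : g ^ 2 * lam i * W ≤ γ₀ * (g * lam i) * W := by
          refine mul_le_mul_of_nonneg_right ?_ hW0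
          nlinarith
        have h5 : 0 ≤ g * lam i * a t₀ i := mul_nonneg hgl0 (ha _ _)
        nlinarith
      refine ⟨hi, ?_⟩
      have h1 : S (t + 1) ≤ S t₀ + (∑' i, lam i) * (γ₀ * W) := by
        simp only [hSdef]
        rw [← tsum_mul_right, ← Summable.tsum_add (hS t₀ (by omega)) (hsum.mul_right _)]
        refine Summable.tsum_le_tsum (fun i => ?_) (hS _ htN)
          ((hS t₀ (by omega)).add (hsum.mul_right _))
        rw [← mul_add]
        exact mul_le_mul_of_nonneg_left (hi i) (hlam i)
      have h2 := mul_le_mul_of_nonneg_left h1 hα.le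
      have h3 : α * ((∑' i, lam i) * (γ₀ * W)) ≤ 1 / 4 * W := by nlinarith
      have h4 := mul_nonneg hα.le (hS0 t₀)
      rw [mul_add] at h2
      linarith
  exact (key t ht₀ ht).2

/-- With `r` the remaining sum of `γ_s l`, `phaseLen_mul_stepsize_le` gives `γ l ≤ (2r + 1) / K`,
while the later contractions supply `exp (-r)`. One factor `exp (-r/2)` turns `γ l` into `4 / K`.
The first bound keeps the other factor for `sum_mul_exp_le`; the second spends it on the second copy
of `γ l`. -/
lemma stepsize_mul_prod_le (hN : 100 < N) (hγ : 0 < γ₀) {l : ℝ} (hl : 0 ≤ l)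
    (hγl : γ₀ * l ≤ 1 / 4) (t : ℕ) :
    stepsize γ₀ N (t + 1) * l * ∏ s ∈ Finset.Ico (t + 1) N, (1 - stepsize γ₀ N (s + 1) * l) ≤
      4 / phaseLen N *
        Real.exp (-(∑ s ∈ Finset.Ico (t + 1) N, stepsize γ₀ N (s + 1) * l) / 2) ∧
    (stepsize γ₀ N (t + 1) * l) ^ 2 *
      ∏ s ∈ Finset.Ico (t + 1) N, (1 - stepsize γ₀ N (s + 1) * l) ≤ 16 / phaseLen N ^ 2 := by
  have hK : (0 : ℝ) < phaseLen N := by exact_mod_cast (by have := two_le_phaseLen hN; omega)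
  have hp := stepsize_pos hγ hN
  have hle : ∀ t, stepsize γ₀ N t * l ≤ 1 := fun t => by
    have := mul_le_mul_of_nonneg_right (stepsize_le hγ hN t) hl
    linarith
  have h1 := prod_one_sub_le_exp (Finset.Ico (t + 1) N)
    (p := fun s => stepsize γ₀ N (s + 1) * l) (fun s => hle _)
  have h2 := phaseLen_mul_stepsize_le hγ hN hl hγl (t + 1)
  rw [Finset.mul_sum] at h2
  simp only [mul_comm l] at h2
  set r := ∑ s ∈ Finset.Ico (t + 1) N, stepsize γ₀ N (s + 1) * l with hr
  have hr0 : 0 ≤ r := Finset.sum_nonneg fun s _ => mul_nonneg (hp _).le hl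
  set x := stepsize γ₀ N (t + 1) * l with hx
  have hx0 : 0 ≤ x := mul_nonneg (hp _).le hl
  have h2' : x ≤ (2 * r + 1) / phaseLen N := by
    rw [le_div_iff₀ hK, hx]; linarith
  have hE : 0 < Real.exp (-r / 2) := Real.exp_pos _
  have hEE : Real.exp (-r) = Real.exp (-r / 2) * Real.exp (-r / 2) := by
    rw [← Real.exp_add]; congr 1; ring
  have h3 : (2 * r + 1) * Real.exp (-r / 2) ≤ 4 := by
    have h4 := Real.add_one_le_exp (r / 2)
    have h5 : Real.exp (r / 2) * Real.exp (-r / 2) = 1 := by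
      rw [← Real.exp_add, ← Real.exp_zero]; congr 1; ring
    nlinarith
  have h4 : x * Real.exp (-r / 2) ≤ 4 / phaseLen N := by
    calc x * Real.exp (-r / 2) ≤ (2 * r + 1) / phaseLen N * Real.exp (-r / 2) :=
          mul_le_mul_of_nonneg_right h2' hE.le
      _ = (2 * r + 1) * Real.exp (-r / 2) / phaseLen N := by ring
      _ ≤ 4 / phaseLen N := div_le_div_of_nonneg_right h3 hK.le
  constructor
  · calc _ ≤ x * Real.exp (-r) := mul_le_mul_of_nonneg_left h1 hx0
      _ = x * Real.exp (-r / 2) * Real.exp (-r / 2) := by rw [hEE]; ring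
      _ ≤ _ := mul_le_mul_of_nonneg_right h4 hE.le
  · calc _ ≤ x ^ 2 * Real.exp (-r) := mul_le_mul_of_nonneg_left h1 (sq_nonneg _)
      _ = (x * Real.exp (-r / 2)) ^ 2 := by rw [hEE]; ring
      _ ≤ (4 / phaseLen N) ^ 2 := pow_le_pow_left₀ (mul_nonneg hx0 hE.le) h4 2
      _ = _ := by rw [div_pow]; norm_num

set_option maxHeartbeats 400000 in
/-- The bound on the weighted sum of the solution of the upper recursion. -/
theorem upper_of_recursion (hN : 100 < N) (hγ : 0 < γ₀) (hα : 0 < α) (hσ : 0 ≤ σ2)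
    (hlam : ∀ i, 0 ≤ lam i) (hsum : Summable lam) (hγl : ∀ i, γ₀ * lam i ≤ 1 / 4)
    (htr : γ₀ * (4 * α * ∑' i, lam i) ≤ 1) (ha : ∀ t i, 0 ≤ a t i)
    (hS : ∀ t ≤ N, Summable fun i => lam i * a t i)
    (hrec : ∀ t < N, ∀ i, a (t + 1) i ≤ (1 - stepsize γ₀ N (t + 1) * lam i) * a t i +
      stepsize γ₀ N (t + 1) ^ 2 * lam i * (α / 2 * (∑' j, lam j * a t j) + σ2)) (k : ℕ) :
    ∑' i, lam i * a N i ≤ 480 *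
      (∑' i, lam i * ((∏ s ∈ Finset.range N, (1 - stepsize γ₀ N (s + 1) / 2 * lam i)) ^ 2 * a 0 i) +
        (α * (1 / (Neff N * γ₀) * ∑ i ∈ Finset.range k, a 0 i +
          ∑' i, lam (k + i) * a 0 (k + i)) + σ2) * (Deff lam γ₀ N k / Neff N)) := by
  have hKnat := two_le_phaseLen hN
  have hKN : phaseLen N ≤ N := by exact_mod_cast phaseLen_le_self hN
  have hNe := two_le_Neff hN
  have hK : (0 : ℝ) < phaseLen N := by exact_mod_cast (by omega : 0 < phaseLen N)
  have hp := stepsize_pos hγ hN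
  have hple := stepsize_le hγ hN
  have hg0 : ∀ t i, 0 ≤ stepsize γ₀ N t * lam i := fun t i => mul_nonneg (hp t).le (hlam i)
  have hg1 : ∀ t i, stepsize γ₀ N t * lam i ≤ 1 / 4 := fun t i =>
    (mul_le_mul_of_nonneg_right (hple t) (hlam i)).trans (hγl i)
  set S : ℕ → ℝ := fun t => ∑' i, lam i * a t i with hSdef
  have hS0 : ∀ t, 0 ≤ S t := fun t => tsum_nonneg fun i => mul_nonneg (hlam i) (ha t i)
  have havg := recursion_average hN hγ hα hσ hlam hsum hγl htr ha hS hrec k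
  have hsup := fun {t₀ t : ℕ} => recursion_sup (t₀ := t₀) (t := t) hN hγ hα hσ hlam hsum hγl
    htr ha hS hrec
  set head := ∑ i ∈ Finset.range k, a 0 i with hhead
  set tail := ∑' i, lam (k + i) * a 0 (k + i) with htail
  have hhead0 : 0 ≤ head := Finset.sum_nonneg fun i _ => ha 0 i
  have htail0 : 0 ≤ tail := tsum_nonneg fun i => mul_nonneg (hlam _) (ha 0 _)
  set Y := α * (1 / (Neff N * γ₀) * head + tail) + σ2 with hY
  have hY0 : 0 ≤ Y := by positivity
  have hσY : σ2 ≤ Y := by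
    have : 0 ≤ α * (1 / (Neff N * γ₀) * head + tail) := by positivity
    linarith
  set M := phaseLen N - 1 with hM
  have hM1 : 1 ≤ M := by omega
  have hMK : (M : ℝ) = phaseLen N - 1 := by
    rw [hM, Nat.cast_sub (by omega)]; norm_num
  have hM0 : (0 : ℝ) < M := by exact_mod_cast hM1
  have hNeM : Neff N ≤ 4 * M := by rw [hMK]; exact Neff_le_four_mul hN
  have hsumS : α * ∑ t ∈ Finset.range M, S t ≤ 8 * M * Y := by
    have h1 : head / γ₀ ≤ 4 * M * (1 / (Neff N * γ₀) * head) := by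
      have h2 : head / γ₀ = Neff N * (1 / (Neff N * γ₀) * head) := by field_simp
      rw [h2]
      exact mul_le_mul_of_nonneg_right hNeM (by positivity)
    have h3 : α * (head / γ₀) ≤ α * (4 * M * (1 / (Neff N * γ₀) * head)) :=
      mul_le_mul_of_nonneg_left h1 hα.le
    have h4 : 0 ≤ α * (M * tail) := by positivity
    have h5 : 0 ≤ M * σ2 := by positivity
    rw [hY]
    linarith
  -- Some time in the initial phase is no worse than the average; started there, `recursion_sup`
  -- controls every later time.
  obtain ⟨t₀, ht₀, ht₀S⟩ : ∃ t ∈ Finset.range M, α * S t ≤ 8 * Y := by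
    refine Finset.exists_le_of_sum_le ⟨0, Finset.mem_range.2 hM1⟩ ?_
    rw [← Finset.mul_sum, Finset.sum_const, Finset.card_range, nsmul_eq_mul]
    linarith
  have hWlate : ∀ t, M ≤ t → t ≤ N → α / 2 * S t + σ2 ≤ 10 * Y := fun t h1 h2 => by
    have h3 := hsup (by have := Finset.mem_range.1 ht₀; omega : t₀ ≤ t) h2
    simp only [hSdef] at ht₀S ⊢
    linarith
  have hWearly : ∑ t ∈ Finset.range M, (α / 2 * S t + σ2) ≤ 5 * phaseLen N * Y := by
    rw [Finset.sum_add_distrib, ← Finset.mul_sum, Finset.sum_const, Finset.card_range,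
      nsmul_eq_mul]
    have h1 : M * σ2 ≤ M * Y := mul_le_mul_of_nonneg_left hσY hM0.le
    have h2 : M * Y ≤ phaseLen N * Y := mul_le_mul_of_nonneg_right (by linarith) hY0
    linarith
  have hW0 : ∀ t, 0 ≤ α / 2 * S t + σ2 := fun t => by have := hS0 t; positivity
  have hNeK := Neff_le_two_mul hN
  have hKNe := phaseLen_le hN
  have hsplit : ∀ f : ℕ → ℝ, ∑ t ∈ Finset.range N, f t =
      ∑ t ∈ Finset.range M, f t + ∑ t ∈ Finset.Ico M N, f t := fun f =>
    (Finset.sum_range_add_sum_Ico f (by omega)).symm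
  -- The noise per direction splits at time `M`: before it only the sum of the driving term is
  -- controlled, after it each value is.
  have hi : ∀ i, lam i * a N i ≤
      lam i * ((∏ s ∈ Finset.range N, (1 - stepsize γ₀ N (s + 1) / 2 * lam i)) ^ 2 * a 0 i) +
      (if i < k then 480 * Y / Neff N else 480 * Y * Neff N * γ₀ ^ 2 * lam i ^ 2) := by
    intro i
    have hl := hlam i
    have h1 := le_unroll (b := fun t => a t i) (p := fun t => 1 - stepsize γ₀ N (t + 1) * lam i)
      (c := fun t => stepsize γ₀ N (t + 1) ^ 2 * lam i * (α / 2 * S t + σ2))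
      (fun t => by linarith [hg1 (t + 1) i]) (fun t ht => hrec t ht i)
    -- Factorwise `1 - x ≤ (1 - x/2)²`, which produces the half stepsize of the bias operator.
    have h2 : ∏ s ∈ Finset.range N, (1 - stepsize γ₀ N (s + 1) * lam i) ≤
        (∏ s ∈ Finset.range N, (1 - stepsize γ₀ N (s + 1) / 2 * lam i)) ^ 2 := by
      rw [← Finset.prod_pow]
      refine Finset.prod_le_prod (fun s _ => by linarith [hg1 (s + 1) i]) fun s _ => ?_
      nlinarith [sq_nonneg (stepsize γ₀ N (s + 1) * lam i)]
    have h3 := mul_le_mul_of_nonneg_left h1 hl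
    have h4 := mul_le_mul_of_nonneg_left (mul_le_mul_of_nonneg_right h2 (ha 0 i)) hl
    rw [mul_add] at h3
    have h5 : lam i * ∑ t ∈ Finset.range N,
          (∏ s ∈ Finset.Ico (t + 1) N, (1 - stepsize γ₀ N (s + 1) * lam i)) *
            (stepsize γ₀ N (t + 1) ^ 2 * lam i * (α / 2 * S t + σ2)) =
        ∑ t ∈ Finset.range N, (stepsize γ₀ N (t + 1) * lam i) ^ 2 *
          (∏ s ∈ Finset.Ico (t + 1) N, (1 - stepsize γ₀ N (s + 1) * lam i)) *
            (α / 2 * S t + σ2) := by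
      rw [Finset.mul_sum]
      exact Finset.sum_congr rfl fun t _ => by ring
    rw [h5] at h3
    refine h3.trans (add_le_add h4 ?_)
    rw [hsplit]
    set Q : ℕ → ℝ := fun t => ∏ s ∈ Finset.Ico (t + 1) N, (1 - stepsize γ₀ N (s + 1) * lam i)
      with hQ
    have hQ0 : ∀ t, 0 ≤ Q t := fun t =>
      Finset.prod_nonneg fun s _ => by linarith [hg1 (s + 1) i]
    have hQ1 : ∀ t, Q t ≤ 1 := fun t =>
      Finset.prod_le_one (fun s _ => by linarith [hg1 (s + 1) i])
        fun s _ => by linarith [hg0 (s + 1) i]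
    split_ifs with hik
    -- Head direction: the early noise uses the pointwise `16 / K²` bound, the late noise the
    -- summable one. Together they give `80 + 160 = 240` times `Y / K`, hence `480 * Y / Neff N`.
    · have e1 : ∑ t ∈ Finset.range M, (stepsize γ₀ N (t + 1) * lam i) ^ 2 * Q t *
          (α / 2 * S t + σ2) ≤ 16 / phaseLen N ^ 2 * (5 * phaseLen N * Y) := by
        refine le_trans ?_ (mul_le_mul_of_nonneg_left hWearly (by positivity))
        rw [Finset.mul_sum]
        exact Finset.sum_le_sum fun t _ => mul_le_mul_of_nonneg_right
          (stepsize_mul_prod_le hN hγ hl (hγl i) t).2 (hW0 t)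
      have e2 : ∑ t ∈ Finset.Ico M N, (stepsize γ₀ N (t + 1) * lam i) ^ 2 * Q t *
          (α / 2 * S t + σ2) ≤ 4 * (4 / phaseLen N * (10 * Y)) := by
        calc _ ≤ ∑ t ∈ Finset.Ico M N, (stepsize γ₀ N (t + 1) * lam i *
              Real.exp (-(∑ s ∈ Finset.Ico (t + 1) N, stepsize γ₀ N (s + 1) * lam i) / 2)) *
                (4 / phaseLen N * (10 * Y)) := by
              refine Finset.sum_le_sum fun t ht => ?_
              have ht := Finset.mem_Ico.1 ht
              have q1 := mul_le_mul_of_nonneg_left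
                (stepsize_mul_prod_le hN hγ hl (hγl i) t).1 (hg0 (t + 1) i)
              have q2 := hWlate t ht.1 ht.2.le
              have q3 : 0 ≤ stepsize γ₀ N (t + 1) * lam i * (4 / phaseLen N * Real.exp
                (-(∑ s ∈ Finset.Ico (t + 1) N, stepsize γ₀ N (s + 1) * lam i) / 2)) :=
                mul_nonneg (hg0 _ _) (by positivity)
              have q4 := mul_le_mul q1 q2 (hW0 t) q3
              simp only [hQ]
              nlinarith
          _ ≤ ∑ t ∈ Finset.range N, (stepsize γ₀ N (t + 1) * lam i *
              Real.exp (-(∑ s ∈ Finset.Ico (t + 1) N, stepsize γ₀ N (s + 1) * lam i) / 2)) *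
                (4 / phaseLen N * (10 * Y)) := by
              rw [hsplit]
              have : 0 ≤ ∑ t ∈ Finset.range M, (stepsize γ₀ N (t + 1) * lam i *
                Real.exp (-(∑ s ∈ Finset.Ico (t + 1) N, stepsize γ₀ N (s + 1) * lam i) / 2)) *
                (4 / phaseLen N * (10 * Y)) := Finset.sum_nonneg fun t _ =>
                  mul_nonneg (mul_nonneg (hg0 _ _) (Real.exp_pos _).le) (by positivity)
              linarith
          _ ≤ _ := by
              rw [← Finset.sum_mul]
              exact mul_le_mul_of_nonneg_right (sum_mul_exp_le
                (g := fun t => stepsize γ₀ N (t + 1) * lam i) (fun t => hg0 _ _)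
                (fun t => by linarith [hg1 (t + 1) i])) (by positivity)
      have e3 : 16 / (phaseLen N : ℝ) ^ 2 * (5 * phaseLen N * Y) + 4 * (4 / phaseLen N * (10 * Y)) =
          240 * Y / phaseLen N := by field_simp; ring
      have e4 : 240 * Y / phaseLen N ≤ 480 * Y / Neff N := by
        rw [div_le_div_iff₀ hK (by linarith)]
        nlinarith
      linarith
    -- Tail direction: the contraction `Q` is dropped, and only the total length `2 K γ₀` of the
    -- stepsizes is used.
    · have hsq : ∀ t, (stepsize γ₀ N (t + 1) * lam i) ^ 2 * Q t ≤
          stepsize γ₀ N (t + 1) * (γ₀ * lam i ^ 2) := fun t => by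
        have q1 : (stepsize γ₀ N (t + 1) * lam i) ^ 2 * Q t ≤
            (stepsize γ₀ N (t + 1) * lam i) ^ 2 :=
          mul_le_of_le_one_right (sq_nonneg _) (hQ1 t)
        have q2 : stepsize γ₀ N (t + 1) * stepsize γ₀ N (t + 1) ≤ stepsize γ₀ N (t + 1) * γ₀ :=
          mul_le_mul_of_nonneg_left (hple _) (hp _).le
        have q3 := mul_le_mul_of_nonneg_right q2 (sq_nonneg (lam i))
        nlinarith
      have e1 : ∑ t ∈ Finset.range M, (stepsize γ₀ N (t + 1) * lam i) ^ 2 * Q t *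
          (α / 2 * S t + σ2) ≤ γ₀ ^ 2 * lam i ^ 2 * (5 * phaseLen N * Y) := by
        refine le_trans ?_ (mul_le_mul_of_nonneg_left hWearly (by positivity))
        rw [Finset.mul_sum]
        refine Finset.sum_le_sum fun t _ => mul_le_mul_of_nonneg_right ?_ (hW0 t)
        refine (hsq t).trans ?_
        have := mul_le_mul_of_nonneg_right (hple (t + 1))
          (by positivity : 0 ≤ γ₀ * lam i ^ 2)
        nlinarith
      have e2 : ∑ t ∈ Finset.Ico M N, (stepsize γ₀ N (t + 1) * lam i) ^ 2 * Q t *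
          (α / 2 * S t + σ2) ≤ 2 * phaseLen N * γ₀ * (γ₀ * lam i ^ 2 * (10 * Y)) := by
        calc _ ≤ ∑ t ∈ Finset.Ico M N, stepsize γ₀ N (t + 1) * (γ₀ * lam i ^ 2 * (10 * Y)) := by
              refine Finset.sum_le_sum fun t ht => ?_
              have ht := Finset.mem_Ico.1 ht
              rw [← mul_assoc]
              exact mul_le_mul (hsq t) (hWlate t ht.1 ht.2.le) (hW0 t)
                (mul_nonneg (hp _).le (by positivity))
          _ ≤ _ := by
              rw [← Finset.sum_mul]
              refine mul_le_mul_of_nonneg_right ((sum_stepsize_le hγ hN M N).trans ?_)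
                (by positivity)
              exact mul_le_mul_of_nonneg_left (hple _) (by positivity)
      have e3 : γ₀ ^ 2 * lam i ^ 2 * (5 * phaseLen N * Y) +
          2 * phaseLen N * γ₀ * (γ₀ * lam i ^ 2 * (10 * Y)) =
          phaseLen N * (25 * Y * γ₀ ^ 2 * lam i ^ 2) := by ring
      have e4 : phaseLen N * (25 * Y * γ₀ ^ 2 * lam i ^ 2) ≤
          Neff N * (25 * Y * γ₀ ^ 2 * lam i ^ 2) :=
        mul_le_mul_of_nonneg_right hKNe (by positivity)
      have e5 : 0 ≤ Y * Neff N * γ₀ ^ 2 * lam i ^ 2 := by positivity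
      linarith
  have hlamsq : Summable fun i => lam (k + i) ^ 2 := by
    have h0 : Summable fun i => lam (k + i) := by
      simpa [add_comm] using (summable_nat_add_iff k).2 hsum
    refine Summable.of_nonneg_of_le (fun i => sq_nonneg _) (fun i => ?_)
      (h0.mul_left (1 / 4 / γ₀))
    have h1 : lam (k + i) ≤ 1 / 4 / γ₀ := by
      rw [le_div_iff₀ hγ]; linarith [hγl (k + i)]
    rw [sq]
    exact mul_le_mul_of_nonneg_right h1 (hlam _)
  have hls : Summable fun i => 480 * Y * Neff N * γ₀ ^ 2 * lam (k + i) ^ 2 := hlamsq.mul_left _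
  have hht := hasSum_head_tail (f := fun _ => 480 * Y / Neff N)
    (g := fun i => 480 * Y * Neff N * γ₀ ^ 2 * lam i ^ 2) k hls
  have hbias : Summable fun i => lam i *
      ((∏ s ∈ Finset.range N, (1 - stepsize γ₀ N (s + 1) / 2 * lam i)) ^ 2 * a 0 i) := by
    refine Summable.of_nonneg_of_le (fun i => mul_nonneg (hlam i)
      (mul_nonneg (sq_nonneg _) (ha 0 i))) (fun i => ?_) (hS 0 (by omega))
    refine mul_le_mul_of_nonneg_left (mul_le_of_le_one_left (ha 0 i) ?_) (hlam i)
    refine pow_le_one₀ (Finset.prod_nonneg fun s _ => ?_) (Finset.prod_le_one (fun s _ => ?_)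
      fun s _ => ?_)
    · linarith [hg1 (s + 1) i]
    · linarith [hg1 (s + 1) i]
    · linarith [hg0 (s + 1) i]
  have hfin := Summable.tsum_le_tsum hi (hS N le_rfl) (hbias.add hht.summable)
  rw [Summable.tsum_add hbias hht.summable, hht.tsum_eq, Finset.sum_const, Finset.card_range,
    nsmul_eq_mul, tsum_mul_left] at hfin
  have hb0 : 0 ≤ ∑' i, lam i *
      ((∏ s ∈ Finset.range N, (1 - stepsize γ₀ N (s + 1) / 2 * lam i)) ^ 2 * a 0 i) :=
    tsum_nonneg fun i => mul_nonneg (hlam i) (mul_nonneg (sq_nonneg _) (ha 0 i))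
  have hD : Y * (Deff lam γ₀ N k / Neff N) =
      k * (Y / Neff N) + Y * Neff N * γ₀ ^ 2 * ∑' i, lam (k + i) ^ 2 := by
    have : Neff N ≠ 0 := by linarith
    rw [Deff]
    field_simp
  rw [hD]
  have hd : (k : ℝ) * (480 * Y / Neff N) = 480 * (k * (Y / Neff N)) := by ring
  rw [hd] at hfin
  linarith

end UpperRecursion

/-! ### The deterministic lower bound. -/

section LowerRecursion

variable {lam : ℕ → ℝ} {a : ℕ → ℕ → ℝ} {γ₀ β σ2 : ℝ} {N : ℕ}

/-- Summability forces `lam` to `0`, so the defining set is bounded and its supremum is attained if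
it is nonempty; for the empty set, `sSup` is `0`, as wanted. -/
lemma kStar_spec (hanti : Antitone lam) (hsum : Summable lam) (hthr : 0 < 1 / (γ₀ * Neff N))
    (i : ℕ) : i < kStar lam γ₀ N ↔ 1 / (γ₀ * Neff N) ≤ lam i := by
  set A : Set ℕ := {k : ℕ | 1 ≤ k ∧ 1 / (γ₀ * Neff N) ≤ lam (k - 1)} with hA
  have hbdd : BddAbove A := by
    obtain ⟨n, hn⟩ := (hsum.tendsto_atTop_zero.eventually_lt_const hthr).exists
    refine ⟨n, fun k hk => ?_⟩
    by_contra hlt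
    exact absurd ((hk.2.trans (hanti (by omega : n ≤ k - 1))).trans_lt hn) (lt_irrefl _)
  constructor
  · intro hi
    have hne : A.Nonempty := by
      by_contra h
      rw [Set.not_nonempty_iff_eq_empty] at h
      change i < sSup A at hi
      simp [h] at hi
    have hmem := Nat.sSup_mem hne hbdd
    exact hmem.2.trans (hanti (by change i < sSup A at hi; omega))
  · intro hi
    exact Nat.lt_of_succ_le (le_csSup hbdd (show i + 1 ∈ A from ⟨by omega, by simpa using hi⟩))

/-- All future steps together have length at most two phases at the current stepsize, so the
exponents `γ_s l / 2` sum to at most `2`. The bound `1 - p ≥ exp (-2p)` and the square account for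
the factor four. -/
lemma exp_le_prod_sq (hN : 100 < N) (hγ : 0 < γ₀) {l : ℝ} (hl : 0 ≤ l) (hγl : γ₀ * l ≤ 1)
    (t n : ℕ) (h : phaseLen N * stepsize γ₀ N t * l ≤ 2) :
    Real.exp (-8) ≤ ∏ s ∈ Finset.Ico t n, (1 - stepsize γ₀ N (s + 1) / 2 * l) ^ 2 := by
  have hp := stepsize_pos hγ hN
  have hple := stepsize_le hγ hN
  have h1 := exp_le_prod_one_sub (Finset.Ico t n) (p := fun s => stepsize γ₀ N (s + 1) / 2 * l)
    (fun s => mul_nonneg (half_pos (hp _)).le hl)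
    (fun s => by
      have := mul_le_mul_of_nonneg_right (hple (s + 1)) hl
      linarith)
  have h2 : ∑ s ∈ Finset.Ico t n, stepsize γ₀ N (s + 1) / 2 * l ≤ 2 := by
    have h3 := mul_le_mul_of_nonneg_right (sum_stepsize_le hγ hN t n) hl
    rw [← Finset.sum_mul, ← Finset.sum_div]
    linarith
  rw [Finset.prod_pow]
  calc Real.exp (-8) = Real.exp (-4) ^ 2 := by rw [← Real.exp_nat_mul]; norm_num
    _ ≤ _ := pow_le_pow_left₀ (Real.exp_pos _).le
      ((Real.exp_le_exp.2 (by linarith)).trans h1) 2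

/-- Keeps only the noise injected during phase `q`; by `exp_le_prod_sq` it survives to the end up to
a constant. -/
lemma le_sum_of_phase (hN : 100 < N) (hγ : 0 < γ₀) {l : ℝ} (hl : 0 ≤ l) (hγl : γ₀ * l ≤ 1)
    {q : ℕ} (hq : (q + 1) * phaseLen N ≤ N) (h : phaseLen N * (γ₀ / 2 ^ q) * l ≤ 2) :
    Neff N / 4 * (γ₀ / 2 ^ q * l) ^ 2 * Real.exp (-8) ≤
      ∑ t ∈ Finset.range N, (stepsize γ₀ N (t + 1) * l) ^ 2 *
        ∏ s ∈ Finset.Ico (t + 1) N, (1 - stepsize γ₀ N (s + 1) / 2 * l) ^ 2 := by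
  have hK := two_le_phaseLen hN
  have hsub : Finset.Ico (q * phaseLen N) ((q + 1) * phaseLen N - 1) ⊆ Finset.range N := by
    intro t ht
    have := Finset.mem_Ico.1 ht
    exact Finset.mem_range.2 (by omega)
  refine le_trans ?_ (Finset.sum_le_sum_of_subset_of_nonneg hsub fun t _ _ =>
    mul_nonneg (sq_nonneg _) (Finset.prod_nonneg fun s _ => sq_nonneg _))
  have h1 : ∀ t ∈ Finset.Ico (q * phaseLen N) ((q + 1) * phaseLen N - 1),
      (γ₀ / 2 ^ q * l) ^ 2 * Real.exp (-8) ≤ (stepsize γ₀ N (t + 1) * l) ^ 2 *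
        ∏ s ∈ Finset.Ico (t + 1) N, (1 - stepsize γ₀ N (s + 1) / 2 * l) ^ 2 := by
    intro t ht
    have ht := Finset.mem_Ico.1 ht
    have hst : stepsize γ₀ N (t + 1) = γ₀ / 2 ^ q :=
      stepsize_of_phase hN (by omega) (by omega)
    rw [hst]
    refine mul_le_mul_of_nonneg_left ?_ (sq_nonneg _)
    exact exp_le_prod_sq hN hγ hl hγl (t + 1) N (by rw [hst]; exact h)
  refine le_trans ?_ (Finset.sum_le_sum h1)
  rw [Finset.sum_const, Nat.card_Ico, nsmul_eq_mul]
  have h2 : (q + 1) * phaseLen N - 1 - q * phaseLen N = phaseLen N - 1 := by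
    rw [add_mul, one_mul]; omega
  rw [h2, Nat.cast_sub (by omega), Nat.cast_one, mul_assoc]
  have := Neff_le_four_mul hN
  exact mul_le_mul_of_nonneg_right (by linarith) (by positivity)

set_option maxHeartbeats 400000 in
/-- The bound on the weighted sum of the solution of the lower recursion. -/
theorem lower_of_recursion (hN : 100 < N) (hγ : 0 < γ₀) (hβ : 0 < β) (hσ : 0 ≤ σ2)
    (hlam : ∀ i, 0 ≤ lam i) (hsum : Summable lam) (hanti : Antitone lam) (hγl : γ₀ * lam 0 < 1)
    (ha : ∀ t i, 0 ≤ a t i) (hS : ∀ t ≤ N, Summable fun i => lam i * a t i)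
    (hrec : ∀ t < N, ∀ i, (1 - stepsize γ₀ N (t + 1) / 2 * lam i) ^ 2 * a t i +
      stepsize γ₀ N (t + 1) ^ 2 * lam i * (β / 4 * (∑' j, lam j * a t j) + σ2) ≤ a (t + 1) i) :
    Real.exp (-16) / 16 *
      (∑' i, lam i * ((∏ s ∈ Finset.range N, (1 - stepsize γ₀ N (s + 1) / 2 * lam i)) ^ 2 * a 0 i) +
        (β * ∑' i, lam (kStar lam γ₀ N + i) * a 0 (kStar lam γ₀ N + i) + σ2) *
          (Deff lam γ₀ N (kStar lam γ₀ N) / Neff N)) ≤ ∑' i, lam i * a N i := by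
  have hNe := two_le_Neff hN
  have hNe0 : 0 < Neff N := by linarith
  have hp := stepsize_pos hγ hN
  have hKNe := phaseLen_le hN
  have hK : (0 : ℝ) < phaseLen N := by
    exact_mod_cast (by have := two_le_phaseLen hN; omega : 0 < phaseLen N)
  have hγl' : ∀ i, γ₀ * lam i < 1 := fun i =>
    (mul_le_mul_of_nonneg_left (hanti (Nat.zero_le i)) hγ.le).trans_lt hγl
  have hks := kStar_spec (γ₀ := γ₀) (N := N) hanti hsum (by positivity)
  set k := kStar lam γ₀ N with hk
  have hsmall : ∀ i, ¬ i < k → Neff N * γ₀ * lam i ≤ 1 := fun i hi => by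
    rw [hks, not_le, lt_div_iff₀ (by positivity)] at hi
    linarith
  set S : ℕ → ℝ := fun t => ∑' i, lam i * a t i with hSdef
  have hS0 : ∀ t, 0 ≤ S t := fun t => tsum_nonneg fun i => mul_nonneg (hlam i) (ha t i)
  set tail := ∑' i, lam (k + i) * a 0 (k + i) with htail
  have htail0 : 0 ≤ tail := tsum_nonneg fun i => mul_nonneg (hlam _) (ha 0 _)
  have hunroll : ∀ n ≤ N, ∀ i, (∏ s ∈ Finset.range n, (1 - stepsize γ₀ N (s + 1) / 2 * lam i) ^ 2)
      * a 0 i + ∑ t ∈ Finset.range n,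
        (∏ s ∈ Finset.Ico (t + 1) n, (1 - stepsize γ₀ N (s + 1) / 2 * lam i) ^ 2) *
        (stepsize γ₀ N (t + 1) ^ 2 * lam i * (β / 4 * S t + σ2)) ≤ a n i := fun n hn i =>
    unroll_le (b := fun t => a t i) (p := fun t => (1 - stepsize γ₀ N (t + 1) / 2 * lam i) ^ 2)
      (fun t => sq_nonneg _) fun t ht => hrec t (by omega) i
  -- In tail directions `K γ₀ λ_i ≤ 1`, so the initial error persists up to the factor `exp (-8)`.
  -- This makes the feedback `β/4 * S t` effective at every step.
  have hSlow : ∀ t ≤ N, Real.exp (-8) * tail ≤ S t := by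
    intro t ht
    have h1 : S t = ∑ i ∈ Finset.range k, lam i * a t i + ∑' i, lam (k + i) * a t (k + i) := by
      simp only [hSdef]
      rw [← (hS t ht).sum_add_tsum_nat_add k]
      simp only [add_comm]
    have h2 : 0 ≤ ∑ i ∈ Finset.range k, lam i * a t i :=
      Finset.sum_nonneg fun i _ => mul_nonneg (hlam i) (ha t i)
    have hsm : ∀ t ≤ N, Summable fun i => lam (k + i) * a t (k + i) := fun t ht => by
      have := (summable_nat_add_iff k).2 (hS t ht)
      simpa [add_comm] using this
    have h3 : Real.exp (-8) * tail ≤ ∑' i, lam (k + i) * a t (k + i) := by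
      rw [htail, ← tsum_mul_left]
      refine Summable.tsum_le_tsum (fun i => ?_) ((hsm 0 (by omega)).mul_left _) (hsm t ht)
      have h4 := hunroll t ht (k + i)
      have h5 : 0 ≤ ∑ s ∈ Finset.range t,
          (∏ r ∈ Finset.Ico (s + 1) t, (1 - stepsize γ₀ N (r + 1) / 2 * lam (k + i)) ^ 2) *
          (stepsize γ₀ N (s + 1) ^ 2 * lam (k + i) * (β / 4 * S s + σ2)) :=
        Finset.sum_nonneg fun s _ => mul_nonneg (Finset.prod_nonneg fun _ _ => sq_nonneg _)
          (by have := hS0 s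
              have := hlam (k + i)
              positivity)
      have h6 := exp_le_prod_sq hN hγ (hlam (k + i)) (hγl' _).le 0 t (by
        have h7 := hsmall (k + i) (by omega)
        have h8 : phaseLen N * γ₀ * lam (k + i) ≤ Neff N * γ₀ * lam (k + i) :=
          mul_le_mul_of_nonneg_right (mul_le_mul_of_nonneg_right hKNe hγ.le) (hlam _)
        change phaseLen N * γ₀ * lam (k + i) ≤ 2
        linarith)
      rw [← Finset.range_eq_Ico] at h6
      have h9 := mul_le_mul_of_nonneg_right h6 (ha 0 (k + i))
      have h10 := mul_le_mul_of_nonneg_left (h9.trans (by linarith : _ ≤ a t (k + i)))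
        (hlam (k + i))
      linarith
    linarith
  set Y := β * tail + σ2 with hY
  have hY0 : 0 ≤ Y := by positivity
  have he1 : Real.exp (-8) ≤ 1 := Real.exp_le_one_iff.2 (by norm_num)
  have he0 : 0 < Real.exp (-8) := Real.exp_pos _
  have hW : ∀ t ≤ N, Real.exp (-8) / 4 * Y ≤ β / 4 * S t + σ2 := fun t ht => by
    have h1 := mul_le_mul_of_nonneg_left (hSlow t ht) hβ.le
    have h2 : Real.exp (-8) / 4 * σ2 ≤ σ2 := mul_le_of_le_one_left hσ (by linarith)
    rw [hY]
    linarith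
  have hee : Real.exp (-16) = Real.exp (-8) * Real.exp (-8) := by
    rw [← Real.exp_add]; norm_num
  have hi : ∀ i,
      lam i * ((∏ s ∈ Finset.range N, (1 - stepsize γ₀ N (s + 1) / 2 * lam i)) ^ 2 * a 0 i) +
      (if i < k then Real.exp (-16) / 16 * Y / Neff N
        else Real.exp (-16) / 16 * Y * Neff N * γ₀ ^ 2 * lam i ^ 2) ≤ lam i * a N i := by
    intro i
    have hl := hlam i
    have h1 := mul_le_mul_of_nonneg_left (hunroll N le_rfl i) hl
    rw [mul_add, Finset.prod_pow] at h1
    refine le_trans (add_le_add le_rfl ?_) h1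
    have h2 : Real.exp (-8) / 4 * Y * ∑ t ∈ Finset.range N, (stepsize γ₀ N (t + 1) * lam i) ^ 2 *
        ∏ s ∈ Finset.Ico (t + 1) N, (1 - stepsize γ₀ N (s + 1) / 2 * lam i) ^ 2 ≤
        lam i * ∑ t ∈ Finset.range N,
        (∏ s ∈ Finset.Ico (t + 1) N, (1 - stepsize γ₀ N (s + 1) / 2 * lam i) ^ 2) *
        (stepsize γ₀ N (t + 1) ^ 2 * lam i * (β / 4 * S t + σ2)) := by
      rw [Finset.mul_sum, Finset.mul_sum]
      refine Finset.sum_le_sum fun t ht => ?_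
      have h3 := hW t (Finset.mem_range.1 ht).le
      have h4 : 0 ≤ (stepsize γ₀ N (t + 1) * lam i) ^ 2 *
        ∏ s ∈ Finset.Ico (t + 1) N, (1 - stepsize γ₀ N (s + 1) / 2 * lam i) ^ 2 :=
        mul_nonneg (sq_nonneg _) (Finset.prod_nonneg fun _ _ => sq_nonneg _)
      have h5 := mul_le_mul_of_nonneg_right h3 h4
      refine h5.trans (le_of_eq ?_)
      ring
    refine le_trans ?_ h2
    split_ifs with hik
    · have h3 := (hks i).1 hik
      rw [div_le_iff₀ (by positivity)] at h3
      -- The phase is chosen by `2 ^ q ≤ λ_i γ₀ N_eff < 2 ^ (q + 1)`: large enough noise, yet no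
      -- later forgetting.
      obtain ⟨q, hq1, hq2⟩ := exists_nat_pow_near (x := lam i * (γ₀ * Neff N)) h3
        (one_lt_two : (1 : ℝ) < 2)
      have hxlt : lam i * (γ₀ * Neff N) < Neff N := by
        have := mul_lt_mul_of_pos_right (hγl' i) hNe0
        linarith
      -- The chosen phase is completed before time `N`: since `γ₀ λ_i < 1`, `2 ^ (q + 1) ≤ 2 N_eff ≤
      -- N`, so `q + 1 ≤ log₂ N`.
      have hqN : (q + 1) * phaseLen N ≤ N := by
        have hlog := two_le_logb hN
        have hN0 : (0 : ℝ) < N := by exact_mod_cast (by omega : 0 < N)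
        have h4 : (2 : ℝ) ^ (q + 1) ≤ N := by
          have h5 : 2 * Neff N ≤ N := by
            rw [Neff, mul_div_assoc', div_le_iff₀ (by linarith)]
            nlinarith
          rw [pow_succ]
          linarith
        have h6 : ((q + 1 : ℕ) : ℝ) ≤ Real.logb 2 N := by
          rw [Real.le_logb_iff_rpow_le (by norm_num) hN0, Real.rpow_natCast]
          exact h4
        have h7 := phaseLen_mul_logb_le hN
        have h8 : ((q + 1 : ℕ) : ℝ) * phaseLen N ≤ N := by nlinarith
        exact_mod_cast h8
      have h2q : (0 : ℝ) < 2 ^ q := by positivity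
      have hle : phaseLen N * (γ₀ / 2 ^ q) * lam i ≤ 2 := by
        have h4 : phaseLen N * (γ₀ * lam i) ≤ Neff N * (γ₀ * lam i) :=
          mul_le_mul_of_nonneg_right hKNe (by positivity)
        have h5 : phaseLen N * (γ₀ / 2 ^ q) * lam i = phaseLen N * (γ₀ * lam i) / 2 ^ q := by
          ring
        rw [h5, div_le_iff₀ h2q]
        rw [pow_succ] at hq2
        linarith
      have hge : 1 / Neff N ≤ γ₀ / 2 ^ q * lam i := by
        rw [div_mul_eq_mul_div, div_le_div_iff₀ hNe0 h2q]
        linarith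
      have h4 := le_sum_of_phase hN hγ hl (hγl' i).le hqN hle
      refine le_trans ?_ (mul_le_mul_of_nonneg_left h4 (by positivity))
      have h5 : (1 / Neff N) ^ 2 ≤ (γ₀ / 2 ^ q * lam i) ^ 2 :=
        pow_le_pow_left₀ (by positivity) hge 2
      have h6 : Real.exp (-16) / 16 * Y / Neff N = Real.exp (-8) / 4 * Y *
          (Neff N / 4 * (1 / Neff N) ^ 2 * Real.exp (-8)) := by
        rw [hee]; field_simp; ring
      rw [h6]
      gcongr
    · have h4 := le_sum_of_phase hN hγ hl (hγl' i).le (q := 0)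
        (by have : phaseLen N ≤ N := by exact_mod_cast phaseLen_le_self hN
            simpa using this) (by
          have h5 := hsmall i hik
          have h6 : phaseLen N * γ₀ * lam i ≤ Neff N * γ₀ * lam i :=
            mul_le_mul_of_nonneg_right (mul_le_mul_of_nonneg_right hKNe hγ.le) hl
          rw [pow_zero, div_one]
          linarith)
      refine le_trans (le_of_eq ?_) (mul_le_mul_of_nonneg_left h4 (by positivity))
      rw [hee, pow_zero, div_one]
      ring
  have hlamsq : Summable fun i => lam (k + i) ^ 2 := by
    have h0 : Summable fun i => lam (k + i) := by
      simpa [add_comm] using (summable_nat_add_iff k).2 hsum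
    refine Summable.of_nonneg_of_le (fun i => sq_nonneg _) (fun i => ?_)
      (h0.mul_left (1 / γ₀))
    have h1 : lam (k + i) ≤ 1 / γ₀ := by
      rw [le_div_iff₀ hγ]; linarith [hγl' (k + i)]
    rw [sq]
    exact mul_le_mul_of_nonneg_right h1 (hlam _)
  have hls : Summable fun i => Real.exp (-16) / 16 * Y * Neff N * γ₀ ^ 2 * lam (k + i) ^ 2 :=
    hlamsq.mul_left _
  have hht := hasSum_head_tail (f := fun _ => Real.exp (-16) / 16 * Y / Neff N)
    (g := fun i => Real.exp (-16) / 16 * Y * Neff N * γ₀ ^ 2 * lam i ^ 2) k hls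
  have hit0 : ∀ i, 0 ≤ (if i < k then Real.exp (-16) / 16 * Y / Neff N
        else Real.exp (-16) / 16 * Y * Neff N * γ₀ ^ 2 * lam i ^ 2) := fun i => by
    split_ifs <;> positivity
  have hb0 : ∀ i, 0 ≤ lam i *
      ((∏ s ∈ Finset.range N, (1 - stepsize γ₀ N (s + 1) / 2 * lam i)) ^ 2 * a 0 i) := fun i =>
    mul_nonneg (hlam i) (mul_nonneg (sq_nonneg _) (ha 0 i))
  have hbias : Summable fun i => lam i *
      ((∏ s ∈ Finset.range N, (1 - stepsize γ₀ N (s + 1) / 2 * lam i)) ^ 2 * a 0 i) :=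
    Summable.of_nonneg_of_le hb0 (fun i => by linarith [hi i, hit0 i]) (hS N le_rfl)
  have hfin := Summable.tsum_le_tsum hi (hbias.add hht.summable) (hS N le_rfl)
  rw [Summable.tsum_add hbias hht.summable, hht.tsum_eq, Finset.sum_const, Finset.card_range,
    nsmul_eq_mul, tsum_mul_left] at hfin
  have hD : Y * (Deff lam γ₀ N k / Neff N) =
      k * (Y / Neff N) + Y * Neff N * γ₀ ^ 2 * ∑' i, lam (k + i) ^ 2 := by
    rw [Deff]
    field_simp
  rw [hD]
  have hd : (k : ℝ) * (Real.exp (-16) / 16 * Y / Neff N) =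
    Real.exp (-16) / 16 * (k * (Y / Neff N)) := by ring
  rw [hd] at hfin
  have he16 : Real.exp (-16) / 16 ≤ 1 := by
    have : Real.exp (-16) ≤ 1 := Real.exp_le_one_iff.2 (by norm_num)
    linarith
  have := mul_le_of_le_one_left (tsum_nonneg (L := .unconditional ℕ) hb0) he16
  linarith

end LowerRecursion

/-! ### Moment operators as quadratic forms. -/

section Moments

variable {E : Type u} [NormedAddCommGroup E] [InnerProductSpace ℝ E]

lemma outer_apply (x z : E) : outer x z = ⟪x, z⟫ • x := InnerProductSpace.rankOne_apply x x z

lemma norm_outer (x : E) : ‖outer x‖ = ‖x‖ ^ 2 := by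
  rw [outer, InnerProductSpace.norm_rankOne, sq]

lemma continuous_outer : Continuous (outer : E → E →L[ℝ] E) := by
  unfold outer
  exact (InnerProductSpace.rankOne ℝ : E →L[ℝ] E →L⋆[ℝ] E →L[ℝ] E).continuous.clm_apply
    continuous_id

lemma outer_mul_outer_mul_outer (x u : E) :
    outer x * outer u * outer x = ⟪x, u⟫ ^ 2 • outer x := by
  ext z
  simp only [mul_apply_eq_comp, outer_apply, map_smul, smul_apply,
    smul_smul, real_inner_comm u x]
  congr 1
  ring

variable [SecondCountableTopology E] [MeasurableSpace E] [BorelSpace E]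

lemma measurable_inner_fst (h : E) : Measurable fun z : E × ℝ => ⟪z.1, h⟫ := by fun_prop

lemma abs_inner_mul_inner_le (x h g : E) : |⟪x, h⟫ * ⟪x, g⟫| ≤ ‖h‖ * ‖g‖ * ‖x‖ ^ 2 := by
  rw [abs_mul]
  calc |⟪x, h⟫| * |⟪x, g⟫| ≤ (‖x‖ * ‖h‖) * (‖x‖ * ‖g‖) :=
        mul_le_mul (abs_real_inner_le_norm _ _) (abs_real_inner_le_norm _ _) (abs_nonneg _)
          (by positivity)
    _ = ‖h‖ * ‖g‖ * ‖x‖ ^ 2 := by ring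

variable {D : Measure (E × ℝ)} {f : E × ℝ → ℝ}

lemma integrable_smul_outer (hf : AEStronglyMeasurable f D)
    (hint : Integrable (fun z => f z * ‖z.1‖ ^ 2) D) :
    Integrable (fun z => f z • outer z.1) D := by
  refine hint.mono (hf.smul (continuous_outer.comp_aestronglyMeasurable
    measurable_fst.aestronglyMeasurable)) (ae_of_all _ fun z => ?_)
  simp [norm_smul, norm_outer]

lemma integrable_mul_inner_mul_inner (hf : AEStronglyMeasurable f D)
    (hint : Integrable (fun z => f z * ‖z.1‖ ^ 2) D) (h g : E) :
    Integrable (fun z => f z * (⟪z.1, h⟫ * ⟪z.1, g⟫)) D := by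
  refine (hint.const_mul (‖h‖ * ‖g‖)).mono (hf.mul ((measurable_inner_fst h).mul
    (measurable_inner_fst g)).aestronglyMeasurable) (ae_of_all _ fun z => ?_)
  have := mul_le_mul_of_nonneg_left (abs_inner_mul_inner_le z.1 h g) (abs_nonneg (f z))
  simp only [Real.norm_eq_abs] at this ⊢
  rw [abs_mul (f z), abs_mul (‖h‖ * ‖g‖), abs_mul (f z),
    abs_of_nonneg (by positivity : 0 ≤ ‖h‖ * ‖g‖), abs_of_nonneg (by positivity : 0 ≤ ‖z.1‖ ^ 2)]
  linarith

variable [CompleteSpace E]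

lemma inner_integral_smul_outer (hf : AEStronglyMeasurable f D)
    (hint : Integrable (fun z => f z * ‖z.1‖ ^ 2) D) (h g : E) :
    ⟪h, (∫ z, f z • outer z.1 ∂D) g⟫ = ∫ z, f z * (⟪z.1, h⟫ * ⟪z.1, g⟫) ∂D := by
  have hi := integrable_smul_outer hf hint
  rw [ContinuousLinearMap.integral_apply hi, ← innerSL_apply_apply ℝ,
    ← ContinuousLinearMap.integral_comp_comm _ (hi.apply_continuousLinearMap g)]
  refine integral_congr_ae (ae_of_all _ fun z => ?_)
  simp only [innerSL_apply_apply, smul_apply, outer_apply, inner_smul_right,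
    real_inner_comm h z.1]
  ring

lemma FourthMoment.integrable_four (hD : FourthMoment D) :
    Integrable (fun z => ‖z.1‖ ^ 4) D := by
  have h : MemLp (fun z : E × ℝ => z.1) ((4 : ℕ) : ENNReal) D := by exact_mod_cast hD
  exact h.integrable_norm_pow (by norm_num)

variable [IsProbabilityMeasure D]

lemma FourthMoment.memLp_two (hD : FourthMoment D) :
    MemLp (fun z : E × ℝ => z.1) 2 D :=
  MemLp.mono_exponent hD (by norm_num)

lemma FourthMoment.integrable_two (hD : FourthMoment D) :
    Integrable (fun z => ‖z.1‖ ^ 2) D := by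
  have h : MemLp (fun z : E × ℝ => z.1) ((2 : ℕ) : ENNReal) D := by exact_mod_cast hD.memLp_two
  exact h.integrable_norm_pow (by norm_num)

lemma inner_cov (hD : FourthMoment D) (h g : E) :
    ⟪h, cov D g⟫ = ∫ z, ⟪z.1, h⟫ * ⟪z.1, g⟫ ∂D := by
  have := inner_integral_smul_outer (D := D) (f := fun _ => 1) aestronglyMeasurable_const
    (by simpa using hD.integrable_two) h g
  simpa [cov] using this

lemma inner_cov_self (hD : FourthMoment D) (h : E) :
    ⟪h, cov D h⟫ = ∫ z, ⟪z.1, h⟫ ^ 2 ∂D := by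
  simp only [inner_cov hD, sq]

lemma inner_cov_comm (hD : FourthMoment D) (h g : E) : ⟪h, cov D g⟫ = ⟪g, cov D h⟫ := by
  simp only [inner_cov hD, mul_comm]

lemma inner_cov_self_nonneg (hD : FourthMoment D) (h : E) : 0 ≤ ⟪h, cov D h⟫ := by
  rw [inner_cov_self hD]
  exact integral_nonneg fun z => sq_nonneg _

/-- Parseval in the basis chosen by `opTrace`. -/
lemma opTrace_cov_mul_outer (u : E) : opTrace (cov D * outer u) = ⟪u, cov D u⟫ := by
  rw [opTrace, ← HilbertBasis.tsum_inner_mul_inner (exists_hilbertBasis ℝ E).choose_spec.choose]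
  refine tsum_congr fun i => ?_
  rw [mul_apply_eq_comp, outer_apply, map_smul, inner_smul_right]

lemma FourthMoment.integrable_sq_mul (hD : FourthMoment D) (u : E) :
    Integrable (fun z => ⟪z.1, u⟫ ^ 2 * ‖z.1‖ ^ 2) D := by
  refine (hD.integrable_four.const_mul (‖u‖ * ‖u‖)).mono
    (((measurable_inner_fst u).pow_const 2).mul (by fun_prop)).aestronglyMeasurable
    (ae_of_all _ fun z => ?_)
  have := mul_le_mul_of_nonneg_right (abs_inner_mul_inner_le z.1 u u) (sq_nonneg ‖z.1‖)
  rw [← sq, abs_of_nonneg (sq_nonneg _)] at this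
  rw [Real.norm_of_nonneg (by positivity), Real.norm_of_nonneg (by positivity)]
  linarith

lemma inner_integral_outer_mul (hD : FourthMoment D) (u h : E) :
    ⟪h, (∫ z, outer z.1 * outer u * outer z.1 ∂D) h⟫ =
      ∫ z, ⟪z.1, u⟫ ^ 2 * ⟪z.1, h⟫ ^ 2 ∂D := by
  simp only [outer_mul_outer_mul_outer]
  rw [inner_integral_smul_outer ((measurable_inner_fst u).pow_const 2).aestronglyMeasurable
    (hD.integrable_sq_mul u)]
  simp only [sq]

/-- Only the rank-one case `A = u uᵀ` of the assumption is needed. -/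
lemma UpperHypercontractive.fourth_le {α : ℝ} (hD : FourthMoment D)
    (hα : UpperHypercontractive D α) (u h : E) :
    ∫ z, ⟪z.1, u⟫ ^ 2 * ⟪z.1, h⟫ ^ 2 ∂D ≤ α * ⟪u, cov D u⟫ * ⟪h, cov D h⟫ := by
  have h1 := hα (outer u) (InnerProductSpace.isPositive_rankOne_self u)
  rw [ContinuousLinearMap.le_def] at h1
  have h2 := h1.inner_nonneg_right h
  rw [sub_apply, inner_sub_right, inner_integral_outer_mul hD,
    opTrace_cov_mul_outer, smul_apply, inner_smul_right] at h2
  linarith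

lemma LowerHypercontractive.le_fourth {β : ℝ} (hD : FourthMoment D)
    (hβ : LowerHypercontractive D β) (u h : E) :
    ⟪u, cov D h⟫ ^ 2 + β * ⟪u, cov D u⟫ * ⟪h, cov D h⟫ ≤
      ∫ z, ⟪z.1, u⟫ ^ 2 * ⟪z.1, h⟫ ^ 2 ∂D := by
  have h1 := hβ (outer u) (InnerProductSpace.isPositive_rankOne_self u)
  rw [ContinuousLinearMap.le_def] at h1
  have h2 := h1.inner_nonneg_right h
  rw [sub_apply, sub_apply, inner_sub_right,
    inner_sub_right, inner_integral_outer_mul hD,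
    opTrace_cov_mul_outer, smul_apply, inner_smul_right,
    mul_apply_eq_comp, mul_apply_eq_comp, outer_apply, map_smul,
    inner_smul_right, inner_cov_comm hD h u] at h2
  linarith

end Moments

/-! ### Diagonalization along the eigenvectors. -/

section Eigen

variable {E : Type u} [NormedAddCommGroup E] [InnerProductSpace ℝ E]
  {H : E →L[ℝ] E} {lam : ℕ → ℝ} {e : ℕ → E}

lemma hasSum_inner_of_hasSum_outer {ι : Type*} {c : ι → ℝ} {w : ι → E} {T : E →L[ℝ] E}
    (hT : HasSum (fun i => c i • outer (w i)) T) (x z : E) :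
    HasSum (fun i => c i * (⟪w i, z⟫ * ⟪x, w i⟫)) ⟪x, T z⟫ := by
  have h1 := (hT.mapL (ContinuousLinearMap.apply ℝ E z)).mapL (innerSL ℝ x)
  simpa [outer_apply, inner_smul_right] using h1

namespace IsEigenDecomp

/-- Treats genuine eigenvectors and zero padding at once, so no later argument distinguishes them.
-/
lemma inner_self (he : IsEigenDecomp H lam e) (i : ℕ) : lam i * ⟪e i, e i⟫ = lam i := by
  rcases he.unit_or_pad i with h | ⟨_, h⟩
  · rw [real_inner_self_eq_norm_sq, h]; ring
  · rw [h, zero_mul]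

lemma inner_apply (he : IsEigenDecomp H lam e) (i : ℕ) (z : E) :
    ⟪e i, H z⟫ = lam i * ⟪e i, z⟫ := by
  refine (hasSum_inner_of_hasSum_outer he.hasSum (e i) z).unique ?_
  convert hasSum_single i (fun j hj => ?_) using 1
  · rw [mul_comm ⟪e i, z⟫, ← mul_assoc, he.inner_self]
  · rw [he.orthogonal i j hj.symm]; ring

lemma hasSum_inner_self (he : IsEigenDecomp H lam e) (z : E) :
    HasSum (fun i => lam i * ⟪e i, z⟫ ^ 2) ⟪z, H z⟫ := by
  convert hasSum_inner_of_hasSum_outer he.hasSum z z using 2 with i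
  rw [real_inner_comm (e i) z, sq]

lemma sum_sq_inner_le (he : IsEigenDecomp H lam e) (x : E) (s : Finset ℕ) :
    ∑ i ∈ s, ⟪e i, x⟫ ^ 2 ≤ ‖x‖ ^ 2 := by
  classical
  have hon : Orthonormal ℝ (fun i : {i // ‖e i‖ = 1} => e i) :=
    ⟨fun i => i.2, fun i j hij => he.orthogonal i j fun h => hij (Subtype.ext h)⟩
  have h1 := hon.sum_inner_products_le x (s := s.subtype fun i => ‖e i‖ = 1)
  simp only [Real.norm_eq_abs, sq_abs] at h1
  rw [Finset.sum_subtype_eq_sum_filter (s := s) (fun i => ⟪e i, x⟫ ^ 2), Finset.sum_filter] at h1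
  refine le_trans (Finset.sum_le_sum fun i _ => ?_) h1
  rcases he.unit_or_pad i with h | ⟨h, _⟩ <;> simp [h]

lemma wnormSq_headProj_add_tailOp (he : IsEigenDecomp H lam e) (c : ℝ) (k : ℕ) (z : E) :
    wnormSq (c • headProj e k + tailOp lam e k) z =
      c * ∑ i ∈ Finset.range k, ⟪e i, z⟫ ^ 2 + ∑' i, lam (k + i) * ⟪e (k + i), z⟫ ^ 2 := by
  have hs : Summable fun i => lam (k + i) • outer (e (k + i)) := by
    simpa [add_comm] using (summable_nat_add_iff k).2 he.hasSum.summable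
  have h1 := hasSum_inner_of_hasSum_outer hs.hasSum z z
  rw [wnormSq, add_apply, inner_add_right, tailOp, ← h1.tsum_eq]
  congr 1
  · simp only [headProj, smul_apply, inner_smul_right,
      sum_apply, inner_sum, outer_apply]
    congr 1
    refine Finset.sum_congr rfl fun i _ => ?_
    rw [real_inner_comm (e i) z, sq]
  · refine tsum_congr fun i => ?_
    rw [real_inner_comm (e (k + i)) z, sq]

lemma wnormSq_tailOp (he : IsEigenDecomp H lam e) (k : ℕ) (z : E) :
    wnormSq (tailOp lam e k) z = ∑' i, lam (k + i) * ⟪e (k + i), z⟫ ^ 2 := by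
  simpa using he.wnormSq_headProj_add_tailOp 0 k z

lemma inner_biasOp (he : IsEigenDecomp H lam e) (γ : ℕ → ℝ) (N i : ℕ) (z : E) :
    ⟪e i, biasOp H γ N z⟫ = (∏ s ∈ Finset.range N, (1 - γ (s + 1) / 2 * lam i)) * ⟪e i, z⟫ := by
  induction N generalizing z with
  | zero => simp [biasOp]
  | succ n ih =>
    have h1 : biasOp H γ (n + 1) = biasOp H γ n * (1 - (γ (n + 1) / 2) • H) := by
      simp [biasOp, List.range_succ]
    rw [h1, mul_apply_eq_comp, ih, Finset.prod_range_succ]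
    simp only [sub_apply, one_apply_eq_self,
      smul_apply, inner_sub_right, inner_smul_right, he.inner_apply]
    ring

lemma wnormSq_biasOp (he : IsEigenDecomp H lam e) (γ : ℕ → ℝ) (N : ℕ) (z : E) :
    wnormSq H (biasOp H γ N z) =
      ∑' i, lam i * ((∏ s ∈ Finset.range N, (1 - γ (s + 1) / 2 * lam i)) ^ 2 * ⟪e i, z⟫ ^ 2) := by
  rw [wnormSq, ← (he.hasSum_inner_self _).tsum_eq]
  refine tsum_congr fun i => ?_
  rw [he.inner_biasOp, mul_pow]

variable [CompleteSpace E]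

/-- The double sum of `λ_i ⟪e i, b j⟫²` has nonnegative terms. Summing over the basis first gives
`λ_i` by Parseval, summing over eigenvectors first gives the diagonal entries of `H`. -/
lemma opTrace_eq (he : IsEigenDecomp H lam e) (hs : Summable lam) :
    opTrace H = ∑' i, lam i := by
  set b := (exists_hilbertBasis ℝ E).choose_spec.choose with hb
  have h1 : ∀ i, HasSum (fun j => lam i * ⟪e i, b j⟫ ^ 2) (lam i) := fun i => by
    have h2 := (b.hasSum_inner_mul_inner (e i) (e i)).mul_left (lam i)
    rw [he.inner_self] at h2
    have h3 : (fun j => lam i * ⟪e i, b j⟫ ^ 2) =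
        fun j => lam i * (⟪e i, b j⟫ * ⟪b j, e i⟫) := by
      funext j
      rw [real_inner_comm (e i) (b j), sq]
    rwa [h3]
  have h2 : Summable (Function.uncurry fun i j => lam i * ⟪e i, b j⟫ ^ 2) := by
    refine (summable_prod_of_nonneg fun p => mul_nonneg (he.nonneg _) (sq_nonneg _)).2
      ⟨fun i => (h1 i).summable, ?_⟩
    simpa only [Function.uncurry_apply_pair, (h1 _).tsum_eq] using hs
  have h3 := h2.tsum_comm
  simp only [(h1 _).tsum_eq] at h3
  rw [opTrace, ← h3]
  exact tsum_congr fun j => (he.hasSum_inner_self (b j)).tsum_eq.symm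

variable [SecondCountableTopology E] [MeasurableSpace E] [BorelSpace E] {D : Measure (E × ℝ)}
  [IsProbabilityMeasure D]

/-- Since `λ_i = E⟪e i, x⟫²`, Bessel's inequality bounds every partial sum by `E‖x‖²`. -/
lemma summable_lam (hD : FourthMoment D) (he : IsEigenDecomp (cov D) lam e) : Summable lam := by
  refine summable_of_sum_le (c := ∫ z, ‖z.1‖ ^ 2 ∂D) he.nonneg fun s => ?_
  have h1 : ∀ i, lam i = ∫ z, ⟪e i, z.1⟫ ^ 2 ∂D := fun i => by
    rw [← he.inner_self i, ← he.inner_apply, inner_cov_self hD]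
    simp only [real_inner_comm]
  have h2 : ∀ i ∈ s, Integrable (fun z : E × ℝ => ⟪e i, z.1⟫ ^ 2) D := fun i _ => by
    have := integrable_mul_inner_mul_inner (D := D) (f := fun _ => 1) aestronglyMeasurable_const
      (by simpa using hD.integrable_two) (e i) (e i)
    simpa [real_inner_comm, sq] using this
  simp only [h1]
  rw [← integral_finsetSum _ h2]
  exact integral_mono (integrable_finsetSum _ h2) hD.integrable_two fun z =>
    he.sum_sq_inner_le z.1 s

end IsEigenDecomp

end Eigen

/-! ### From ReLU to linear predictors by sector symmetry. -/

section Symmetry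

lemma relu_abs_sub_le (a b : ℝ) : |relu a - relu b| ≤ |a - b| := abs_max_sub_max_le_abs a b 0

lemma measurable_relu : Measurable relu := measurable_id.max measurable_const

/-- The indicator of the open first quadrant. -/
noncomputable def quadrant (a b : ℝ) : ℝ := if 0 < a ∧ 0 < b then 1 else 0

lemma abs_quadrant_le (a b : ℝ) : |quadrant a b| ≤ 1 := by
  unfold quadrant; split_ifs <;> simp

/-- Each term squares the second argument of its own `quadrant`, exactly the shape the symmetry
assumption covers. The regions are `0 < b < a`, `0 < a < b`, and those where only one of `a`, `b` is
positive. -/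
lemma relu_sub_sq (a b : ℝ) : (relu a - relu b) ^ 2 =
    quadrant b (a - b) * (a - b) ^ 2 + quadrant a (b - a) * (b - a) ^ 2 + quadrant a a * a ^ 2
      - quadrant b a * a ^ 2 + quadrant b b * b ^ 2 - quadrant a b * b ^ 2 := by
  unfold quadrant relu
  rcases lt_trichotomy a 0 with ha | ha | ha <;> rcases lt_trichotomy b 0 with hb | hb | hb <;>
    rcases lt_trichotomy a b with hab | hab | hab <;>
    first
    | exfalso; linarith
    | simp [ha, hb, hab, ha.le, hb.le, not_lt.2 ha.le, not_lt.2 hb.le, not_lt.2 hab.le]; done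
    | (simp [ha, hb, hab, ha.le, hb.le, not_lt.2 hab.le]; ring1)

/-- For equal signs the sum is `(a - b)²`; for opposite signs it is `a² + b²`, which is at least
half of `(a - b)²`. -/
lemma relu_sub_sq_add (a b : ℝ) :
    1 / 2 * (a - b) ^ 2 ≤ (relu a - relu b) ^ 2 + (relu (-a) - relu (-b)) ^ 2 ∧
    (relu a - relu b) ^ 2 + (relu (-a) - relu (-b)) ^ 2 ≤ (a - b) ^ 2 := by
  unfold relu
  rcases le_total a 0 with ha | ha <;> rcases le_total b 0 with hb | hb <;>
    simp only [ha, hb, max_eq_left, max_eq_right, neg_nonneg, neg_nonpos] <;>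
    constructor <;> nlinarith [sq_nonneg (a + b), sq_nonneg (a - b)]

variable {E : Type u} [NormedAddCommGroup E] [InnerProductSpace ℝ E] [CompleteSpace E]
  [SecondCountableTopology E] [MeasurableSpace E] [BorelSpace E]
  {D : Measure (E × ℝ)} [IsProbabilityMeasure D]

lemma measurable_quadrant (u v : E) :
    Measurable fun z : E × ℝ => quadrant ⟪z.1, u⟫ ⟪z.1, v⟫ := by
  unfold quadrant
  refine Measurable.ite ?_ measurable_const measurable_const
  exact (measurableSet_lt measurable_const (measurable_inner_fst u)).inter
    (measurableSet_lt measurable_const (measurable_inner_fst v))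

lemma setIntegral_pos_eq (u v : E) (F : E × ℝ → ℝ) :
    ∫ z in {z : E × ℝ | 0 < ⟪z.1, u⟫ ∧ 0 < ⟪z.1, v⟫}, F z ∂D =
      ∫ z, quadrant ⟪z.1, u⟫ ⟪z.1, v⟫ * F z ∂D := by
  have hm : MeasurableSet {z : E × ℝ | 0 < ⟪z.1, u⟫ ∧ 0 < ⟪z.1, v⟫} :=
    (measurableSet_lt measurable_const (measurable_inner_fst u)).inter
      (measurableSet_lt measurable_const (measurable_inner_fst v))
  rw [← integral_indicator hm]
  refine integral_congr_ae (ae_of_all _ fun z => ?_)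
  simp [quadrant, Set.indicator_apply]

lemma setIntegral_neg_eq (u v : E) (F : E × ℝ → ℝ) :
    ∫ z in {z : E × ℝ | ⟪z.1, u⟫ < 0 ∧ ⟪z.1, v⟫ < 0}, F z ∂D =
      ∫ z, quadrant ⟪z.1, -u⟫ ⟪z.1, -v⟫ * F z ∂D := by
  rw [← setIntegral_pos_eq]
  simp only [inner_neg_right, neg_pos]

lemma SymmetricFeatures.second_inner (hS : SymmetricFeatures D) (hD : FourthMoment D)
    (u v h g : E) :
    ∫ z, quadrant ⟪z.1, u⟫ ⟪z.1, v⟫ * (⟪z.1, h⟫ * ⟪z.1, g⟫) ∂D =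
      ∫ z, quadrant ⟪z.1, -u⟫ ⟪z.1, -v⟫ * (⟪z.1, h⟫ * ⟪z.1, g⟫) ∂D := by
  have key : ∀ S : Set (E × ℝ), ⟪h, (∫ z in S, outer z.1 ∂D) g⟫ =
      ∫ z in S, ⟪z.1, h⟫ * ⟪z.1, g⟫ ∂D := fun S => by
    have := inner_integral_smul_outer (D := D.restrict S) (f := fun _ => 1)
      aestronglyMeasurable_const (by simpa using hD.integrable_two.restrict) h g
    simpa using this
  rw [← setIntegral_pos_eq, ← setIntegral_neg_eq, ← key, ← key, hS.second]

lemma SymmetricFeatures.fourth_inner (hS : SymmetricFeatures D) (hD : FourthMoment D)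
    (h u v : E) :
    ∫ z, quadrant ⟪z.1, u⟫ ⟪z.1, v⟫ * (⟪z.1, v⟫ ^ 2 * ⟪z.1, h⟫ ^ 2) ∂D =
      ∫ z, quadrant ⟪z.1, -u⟫ ⟪z.1, -v⟫ * (⟪z.1, v⟫ ^ 2 * ⟪z.1, h⟫ ^ 2) ∂D := by
  have key : ∀ S : Set (E × ℝ), ⟪h, (∫ z in S, ⟪z.1, v⟫ ^ 2 • outer z.1 ∂D) h⟫ =
      ∫ z in S, ⟪z.1, v⟫ ^ 2 * ⟪z.1, h⟫ ^ 2 ∂D := fun S => by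
    rw [inner_integral_smul_outer (D := D.restrict S)
      ((measurable_inner_fst v).pow_const 2).aestronglyMeasurable
      (hD.integrable_sq_mul v).restrict]
    simp only [sq]
  rw [← setIntegral_pos_eq, ← setIntegral_neg_eq, ← key, ← key, hS.fourth]

/-- The half-spaces `⟪x, w⟫ > 0` and `⟪x, w⟫ < 0` contribute equally to `⟪w, H h⟫`, and the ReLU
keeps just one of them. -/
lemma integral_relu_mul_inner (hS : SymmetricFeatures D) (hD : FourthMoment D) (w h : E) :
    ∫ z, relu ⟪z.1, w⟫ * ⟪z.1, h⟫ ∂D = 1 / 2 * ⟪w, cov D h⟫ := by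
  have hi : Integrable (fun z : E × ℝ => ⟪z.1, w⟫ * ⟪z.1, h⟫) D := by
    simpa using integrable_mul_inner_mul_inner (D := D) (f := fun _ => 1)
      aestronglyMeasurable_const (by simpa using hD.integrable_two) w h
  have hq : ∀ u v : E, Integrable
      (fun z : E × ℝ => quadrant ⟪z.1, u⟫ ⟪z.1, v⟫ * (⟪z.1, w⟫ * ⟪z.1, h⟫)) D := fun u v =>
    hi.bdd_mul (measurable_quadrant u v).aestronglyMeasurable
      (ae_of_all _ fun z => abs_quadrant_le _ _)
  have h1 := hS.second_inner hD w w w h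
  have h2 : ∫ z, quadrant ⟪z.1, w⟫ ⟪z.1, w⟫ * (⟪z.1, w⟫ * ⟪z.1, h⟫) ∂D +
      ∫ z, quadrant ⟪z.1, -w⟫ ⟪z.1, -w⟫ * (⟪z.1, w⟫ * ⟪z.1, h⟫) ∂D = ⟪w, cov D h⟫ := by
    rw [inner_cov hD, ← integral_add (hq _ _) (hq _ _)]
    refine integral_congr_ae (ae_of_all _ fun z => ?_)
    simp only [quadrant, inner_neg_right, and_self, neg_pos]
    rcases lt_trichotomy ⟪z.1, w⟫ 0 with h | h | h
    · simp [h, not_lt.2 h.le]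
    · simp [h]
    · simp [h, not_lt.2 h.le]
  have h3 : ∫ z, relu ⟪z.1, w⟫ * ⟪z.1, h⟫ ∂D =
      ∫ z, quadrant ⟪z.1, w⟫ ⟪z.1, w⟫ * (⟪z.1, w⟫ * ⟪z.1, h⟫) ∂D := by
    refine integral_congr_ae (ae_of_all _ fun z => ?_)
    simp only [quadrant, relu, and_self]
    split_ifs with h
    · rw [max_eq_left h.le, one_mul]
    · rw [max_eq_right (not_lt.1 h), zero_mul, zero_mul]
  linarith

/-- Under a sector symmetry for the weight `φ`, the weighted squared difference of two ReLU
neurons is comparable to that of the two linear predictors. -/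
lemma integral_relu_sub_sq_bounds {φ : E × ℝ → ℝ} (hφ : Measurable φ) (hφ0 : ∀ z, 0 ≤ φ z)
    (hint : Integrable (fun z => ‖z.1‖ ^ 2 * φ z) D)
    (hsym : ∀ u v : E, ∫ z, quadrant ⟪z.1, u⟫ ⟪z.1, v⟫ * (⟪z.1, v⟫ ^ 2 * φ z) ∂D =
      ∫ z, quadrant ⟪z.1, -u⟫ ⟪z.1, -v⟫ * (⟪z.1, v⟫ ^ 2 * φ z) ∂D) (w w' : E) :
    1 / 4 * ∫ z, ⟪z.1, w - w'⟫ ^ 2 * φ z ∂D ≤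
      ∫ z, (relu ⟪z.1, w⟫ - relu ⟪z.1, w'⟫) ^ 2 * φ z ∂D ∧
    ∫ z, (relu ⟪z.1, w⟫ - relu ⟪z.1, w'⟫) ^ 2 * φ z ∂D ≤
      1 / 2 * ∫ z, ⟪z.1, w - w'⟫ ^ 2 * φ z ∂D := by
  have hi : ∀ v : E, Integrable (fun z : E × ℝ => ⟪z.1, v⟫ ^ 2 * φ z) D := fun v => by
    refine (hint.const_mul (‖v‖ * ‖v‖)).mono
      (((measurable_inner_fst v).pow_const 2).mul hφ).aestronglyMeasurable
      (ae_of_all _ fun z => ?_)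
    have := mul_le_mul_of_nonneg_right (abs_inner_mul_inner_le z.1 v v) (hφ0 z)
    rw [← sq, abs_of_nonneg (sq_nonneg _)] at this
    have h0 := hφ0 z
    rw [Real.norm_of_nonneg (by positivity), Real.norm_of_nonneg (by positivity)]
    linarith
  set F : E → E → E × ℝ → ℝ := fun u v z => quadrant ⟪z.1, u⟫ ⟪z.1, v⟫ * (⟪z.1, v⟫ ^ 2 * φ z)
    with hFdef
  have hF : ∀ u v, Integrable (F u v) D := fun u v =>
    (hi v).bdd_mul (measurable_quadrant u v).aestronglyMeasurable
      (ae_of_all _ fun z => abs_quadrant_le _ _)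
  have hFsym : ∀ u v, ∫ z, F (-u) (-v) z ∂D = ∫ z, F u v z ∂D := fun u v => by
    simp only [hFdef]
    rw [hsym u v]
    simp only [inner_neg_right, neg_sq]
  have hexp : ∀ w w' : E, ∫ z, (relu ⟪z.1, w⟫ - relu ⟪z.1, w'⟫) ^ 2 * φ z ∂D =
      ∫ z, F w' (w - w') z ∂D + ∫ z, F w (w' - w) z ∂D + ∫ z, F w w z ∂D - ∫ z, F w' w z ∂D +
        ∫ z, F w' w' z ∂D - ∫ z, F w w' z ∂D := fun w w' => by
    rw [← integral_add' (hF _ _) (hF _ _), ← integral_add' ((hF _ _).add (hF _ _)) (hF _ _),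
      ← integral_sub' (((hF _ _).add (hF _ _)).add (hF _ _)) (hF _ _),
      ← integral_add' ((((hF _ _).add (hF _ _)).add (hF _ _)).sub (hF _ _)) (hF _ _),
      ← integral_sub' (((((hF _ _).add (hF _ _)).add (hF _ _)).sub (hF _ _)).add (hF _ _))
        (hF _ _)]
    refine integral_congr_ae (ae_of_all _ fun z => ?_)
    simp only [hFdef, relu_sub_sq, inner_sub_right, Pi.add_apply, Pi.sub_apply]
    ring
  -- Negating both parameters negates every sector of the expansion, and each sector integral is
  -- invariant.
  have hneg : ∫ z, (relu ⟪z.1, -w⟫ - relu ⟪z.1, -w'⟫) ^ 2 * φ z ∂D =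
      ∫ z, (relu ⟪z.1, w⟫ - relu ⟪z.1, w'⟫) ^ 2 * φ z ∂D := by
    rw [hexp, hexp, ← hFsym w' (w - w'), ← hFsym w (w' - w), ← hFsym w w, ← hFsym w' w,
      ← hFsym w' w', ← hFsym w w']
    simp only [neg_sub, sub_neg_eq_add, neg_add_eq_sub]
  have hs : ∀ w w' : E, Integrable
      (fun z : E × ℝ => (relu ⟪z.1, w⟫ - relu ⟪z.1, w'⟫) ^ 2 * φ z) D := fun w w' => by
    refine (hi (w - w')).mono ((((measurable_relu.comp (measurable_inner_fst w)).sub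
      (measurable_relu.comp (measurable_inner_fst w'))).pow_const 2).mul hφ).aestronglyMeasurable
      (ae_of_all _ fun z => ?_)
    have h0 := hφ0 z
    rw [Real.norm_of_nonneg (by positivity), Real.norm_of_nonneg (by positivity)]
    refine mul_le_mul_of_nonneg_right (sq_le_sq.2 ?_) h0
    rw [inner_sub_right]
    exact relu_abs_sub_le _ _
  have hsum : 2 * ∫ z, (relu ⟪z.1, w⟫ - relu ⟪z.1, w'⟫) ^ 2 * φ z ∂D =
      ∫ z, ((relu ⟪z.1, w⟫ - relu ⟪z.1, w'⟫) ^ 2 * φ z +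
        (relu ⟪z.1, -w⟫ - relu ⟪z.1, -w'⟫) ^ 2 * φ z) ∂D := by
    rw [integral_add (hs _ _) (hs _ _), hneg]
    ring
  have hlow : ∫ z, 1 / 2 * (⟪z.1, w - w'⟫ ^ 2 * φ z) ∂D ≤
      2 * ∫ z, (relu ⟪z.1, w⟫ - relu ⟪z.1, w'⟫) ^ 2 * φ z ∂D := by
    rw [hsum]
    refine integral_mono ((hi _).const_mul _) ((hs _ _).add (hs _ _)) fun z => ?_
    have := mul_le_mul_of_nonneg_right (relu_sub_sq_add ⟪z.1, w⟫ ⟪z.1, w'⟫).1 (hφ0 z)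
    simp only [inner_sub_right, inner_neg_right]
    linarith
  have hupp : 2 * ∫ z, (relu ⟪z.1, w⟫ - relu ⟪z.1, w'⟫) ^ 2 * φ z ∂D ≤
      ∫ z, ⟪z.1, w - w'⟫ ^ 2 * φ z ∂D := by
    rw [hsum]
    refine integral_mono ((hs _ _).add (hs _ _)) (hi _) fun z => ?_
    have := mul_le_mul_of_nonneg_right (relu_sub_sq_add ⟪z.1, w⟫ ⟪z.1, w'⟫).2 (hφ0 z)
    simp only [inner_sub_right, inner_neg_right]
    linarith
  rw [integral_const_mul] at hlow
  constructor <;> linarith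

lemma integral_relu_sub_sq_mem (hS : SymmetricFeatures D) (hD : FourthMoment D) (w w' : E) :
    1 / 4 * ⟪w - w', cov D (w - w')⟫ ≤ ∫ z, (relu ⟪z.1, w⟫ - relu ⟪z.1, w'⟫) ^ 2 ∂D ∧
    ∫ z, (relu ⟪z.1, w⟫ - relu ⟪z.1, w'⟫) ^ 2 ∂D ≤ 1 / 2 * ⟪w - w', cov D (w - w')⟫ := by
  have h := integral_relu_sub_sq_bounds (D := D) (φ := fun _ => 1) measurable_const
    (fun _ => zero_le_one) (by simpa using hD.integrable_two)
    (fun u v => by simpa [sq] using hS.second_inner hD u v v v) w w'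
  rw [inner_cov_self hD]
  simpa only [mul_one] using h

lemma integral_relu_sub_sq_mul_mem (hS : SymmetricFeatures D) (hD : FourthMoment D)
    (w w' h : E) :
    1 / 4 * ∫ z, ⟪z.1, w - w'⟫ ^ 2 * ⟪z.1, h⟫ ^ 2 ∂D ≤
      ∫ z, (relu ⟪z.1, w⟫ - relu ⟪z.1, w'⟫) ^ 2 * ⟪z.1, h⟫ ^ 2 ∂D ∧
    ∫ z, (relu ⟪z.1, w⟫ - relu ⟪z.1, w'⟫) ^ 2 * ⟪z.1, h⟫ ^ 2 ∂D ≤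
      1 / 2 * ∫ z, ⟪z.1, w - w'⟫ ^ 2 * ⟪z.1, h⟫ ^ 2 ∂D :=
  integral_relu_sub_sq_bounds ((measurable_inner_fst h).pow_const 2) (fun _ => sq_nonneg _)
    (by simpa [mul_comm] using hD.integrable_sq_mul h) (hS.fourth_inner hD h) w w'

end Symmetry

/-! ### One step of the algorithm, in mean square. -/

section OneStep

variable {E : Type u} [NormedAddCommGroup E] [InnerProductSpace ℝ E] [CompleteSpace E]
  [SecondCountableTopology E] [MeasurableSpace E] [BorelSpace E]
  {D : Measure (E × ℝ)} [IsProbabilityMeasure D] {wstar : E}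

/-- The additive label noise. -/
noncomputable def noise (wstar : E) (z : E × ℝ) : ℝ := z.2 - relu ⟪z.1, wstar⟫

lemma measurable_noise (wstar : E) : Measurable (noise wstar) :=
  measurable_snd.sub (measurable_relu.comp (measurable_inner_fst wstar))

lemma abs_relu_inner_sub_le (x w w' : E) :
    |relu ⟪x, w⟫ - relu ⟪x, w'⟫| ≤ ‖w - w'‖ * ‖x‖ := by
  refine (relu_abs_sub_le _ _).trans ?_
  rw [← inner_sub_right, mul_comm]
  exact abs_real_inner_le_norm _ _

lemma memLp_relu_sub (hD : FourthMoment D) (w w' : E) :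
    MemLp (fun z : E × ℝ => relu ⟪z.1, w⟫ - relu ⟪z.1, w'⟫) 2 D :=
  hD.memLp_two.of_le_mul (c := ‖w - w'‖)
    ((measurable_relu.comp (measurable_inner_fst w)).sub
      (measurable_relu.comp (measurable_inner_fst w'))).aestronglyMeasurable
    (ae_of_all _ fun z => abs_relu_inner_sub_le z.1 w w')

lemma memLp_inner (hD : FourthMoment D) (h : E) : MemLp (fun z : E × ℝ => ⟪z.1, h⟫) 2 D :=
  hD.memLp_two.of_le_mul (c := ‖h‖) (measurable_inner_fst h).aestronglyMeasurable
    (ae_of_all _ fun z => by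
      rw [mul_comm]
      exact abs_real_inner_le_norm _ _)

lemma memLp_relu (hD : FourthMoment D) (w : E) : MemLp (fun z : E × ℝ => relu ⟪z.1, w⟫) 2 D := by
  simpa [relu] using memLp_relu_sub hD w 0

lemma memLp_relu_sub_mul_inner (hD : FourthMoment D) (w w' h : E) :
    MemLp (fun z : E × ℝ => (relu ⟪z.1, w⟫ - relu ⟪z.1, w'⟫) * ⟪z.1, h⟫) 2 D := by
  have hm : Measurable fun z : E × ℝ => (relu ⟪z.1, w⟫ - relu ⟪z.1, w'⟫) * ⟪z.1, h⟫ :=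
    ((measurable_relu.comp (measurable_inner_fst w)).sub
      (measurable_relu.comp (measurable_inner_fst w'))).mul (measurable_inner_fst h)
  rw [memLp_two_iff_integrable_sq hm.aestronglyMeasurable]
  refine (hD.integrable_four.const_mul ((‖w - w'‖ * ‖h‖) ^ 2)).mono
    (hm.pow_const 2).aestronglyMeasurable (ae_of_all _ fun z => ?_)
  rw [Real.norm_of_nonneg (by positivity), Real.norm_of_nonneg (by positivity),
    show (‖w - w'‖ * ‖h‖) ^ 2 * ‖z.1‖ ^ 4 = (‖w - w'‖ * ‖z.1‖ * (‖z.1‖ * ‖h‖)) ^ 2 by ring,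
    ← sq_abs, abs_mul]
  refine pow_le_pow_left₀ (by positivity) (mul_le_mul (abs_relu_inner_sub_le z.1 w w')
    (abs_real_inner_le_norm _ _) (abs_nonneg _) (by positivity)) 2

namespace WellSpecified

lemma memLp_noise (hW : WellSpecified D wstar) (hD : FourthMoment D) :
    MemLp (noise wstar) 2 D := hW.memLp_label.sub (memLp_relu hD wstar)

lemma memLp_noise_mul_inner (hW : WellSpecified D wstar) (h : E) :
    MemLp (fun z : E × ℝ => noise wstar z * ⟪z.1, h⟫) 2 D := by
  have hm : Measurable fun z : E × ℝ => noise wstar z * ⟪z.1, h⟫ :=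
    (measurable_noise wstar).mul (measurable_inner_fst h)
  rw [memLp_two_iff_integrable_sq hm.aestronglyMeasurable]
  refine (hW.integrable_noise.const_mul (‖h‖ ^ 2)).mono
    (hm.pow_const 2).aestronglyMeasurable (ae_of_all _ fun z => ?_)
  rw [Real.norm_of_nonneg (by positivity), Real.norm_of_nonneg (by positivity), mul_pow]
  have h1 : ⟪z.1, h⟫ ^ 2 ≤ (‖z.1‖ * ‖h‖) ^ 2 := by
    rw [← sq_abs]
    exact pow_le_pow_left₀ (abs_nonneg _) (abs_real_inner_le_norm _ _) 2
  have h2 := mul_le_mul_of_nonneg_left h1 (sq_nonneg (noise wstar z))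
  simp only [noise] at h2 ⊢
  nlinarith

lemma integral_mul_noise (hW : WellSpecified D wstar) (hD : FourthMoment D) {g : E → ℝ}
    (hg : Measurable g) (hint : Integrable (fun z => g z.1 * noise wstar z) D) :
    ∫ z, g z.1 * noise wstar z ∂D = 0 := by
  set m : MeasurableSpace (E × ℝ) := MeasurableSpace.comap Prod.fst inferInstance with hm
  have hle : m ≤ Prod.instMeasurableSpace := measurable_fst.comap_le
  have hfst : Measurable[m] (Prod.fst : E × ℝ → E) := comap_measurable _
  have hrelu : Integrable (fun z : E × ℝ => relu ⟪z.1, wstar⟫) D :=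
    (memLp_relu hD wstar).integrable (by norm_num)
  have hlab : Integrable (fun z : E × ℝ => z.2) D := hW.memLp_label.integrable (by norm_num)
  have h1 : D[noise wstar | m] =ᵐ[D] 0 := by
    have h2 := condExp_sub hlab hrelu m
    have h3 : D[fun z : E × ℝ => relu ⟪z.1, wstar⟫ | m] = fun z => relu ⟪z.1, wstar⟫ := by
      refine condExp_of_stronglyMeasurable hle ?_ hrelu
      have hc : Measurable fun x : E => relu ⟪x, wstar⟫ := measurable_relu.comp (by fun_prop)
      exact (hc.comp hfst).stronglyMeasurable
    refine h2.trans ?_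
    filter_upwards [hW.condExp_label] with z hz
    rw [Pi.sub_apply, h3, hz, sub_self, Pi.zero_apply]
  have h4 := condExp_mul_of_stronglyMeasurable_left (μ := D) (m := m)
    (f := fun z : E × ℝ => g z.1) (g := noise wstar) (hg.comp hfst).stronglyMeasurable hint
    ((hW.memLp_noise hD).integrable (by norm_num))
  have h5 := integral_condExp (μ := D) (f := fun z => g z.1 * noise wstar z) hle
  rw [← h5]
  refine integral_eq_zero_of_ae (h4.trans ?_)
  filter_upwards [h1] with z hz
  simp [hz]

lemma risk_eq (wstar : E) : risk D wstar = ∫ z, noise wstar z ^ 2 ∂D := by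
  refine integral_congr_ae (ae_of_all _ fun z => ?_)
  simp only [noise]
  ring

lemma risk_nonneg : 0 ≤ risk D wstar := integral_nonneg fun _ => sq_nonneg _

lemma integral_noise_sq_mul (hW : WellSpecified D wstar) (h : E) :
    ∫ z, noise wstar z ^ 2 * ⟪z.1, h⟫ ^ 2 ∂D = risk D wstar * ⟪h, cov D h⟫ := by
  have h1 := inner_integral_smul_outer (D := D) (f := fun z => noise wstar z ^ 2)
    ((measurable_noise wstar).pow_const 2).aestronglyMeasurable hW.integrable_noise h h
  have h2 := hW.noise_cov
  change ∫ z, noise wstar z ^ 2 • outer z.1 ∂D = _ at h2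
  rw [h2, smul_apply, inner_smul_right] at h1
  rw [h1]
  simp only [sq]

/-- The noise has conditional mean zero given the features, so the cross term vanishes. -/
lemma excessRisk_eq (hW : WellSpecified D wstar) (hD : FourthMoment D) (w : E) :
    excessRisk D wstar w = ∫ z, (relu ⟪z.1, w⟫ - relu ⟪z.1, wstar⟫) ^ 2 ∂D := by
  have hs := memLp_relu_sub hD w wstar
  have hn := hW.memLp_noise hD
  have hsn : Integrable (fun z => (relu ⟪z.1, w⟫ - relu ⟪z.1, wstar⟫) * noise wstar z) D :=
    hs.integrable_mul hn
  have hdiff : Integrable (fun z => (relu ⟪z.1, w⟫ - relu ⟪z.1, wstar⟫) ^ 2 -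
      2 * ((relu ⟪z.1, w⟫ - relu ⟪z.1, wstar⟫) * noise wstar z)) D :=
    hs.integrable_sq.sub (hsn.const_mul 2)
  have h0 := hW.integral_mul_noise hD
    (g := fun x => relu ⟪x, w⟫ - relu ⟪x, wstar⟫)
    ((measurable_relu.comp (by fun_prop)).sub (measurable_relu.comp (by fun_prop))) hsn
  have h1 : risk D w = ∫ z, ((relu ⟪z.1, w⟫ - relu ⟪z.1, wstar⟫) ^ 2 -
      2 * ((relu ⟪z.1, w⟫ - relu ⟪z.1, wstar⟫) * noise wstar z) + noise wstar z ^ 2) ∂D := by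
    refine integral_congr_ae (ae_of_all _ fun z => ?_)
    simp only [noise]
    ring
  rw [integral_add hdiff hn.integrable_sq,
    integral_sub hs.integrable_sq (hsn.const_mul 2), integral_const_mul, h0, ← risk_eq] at h1
  rw [excessRisk, h1]
  ring

end WellSpecified

/-- One step of GLM-tron with stepsize `γ` on the sample `z`. -/
noncomputable def glmStep (γ : ℝ) (w : E) (z : E × ℝ) : E :=
  w - (γ * (relu ⟪z.1, w⟫ - z.2)) • z.1

lemma inner_glmStep_sub (γ : ℝ) (wstar w : E) (z : E × ℝ) (h : E) :
    ⟪glmStep γ w z - wstar, h⟫ = ⟪w - wstar, h⟫ -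
      γ * ((relu ⟪z.1, w⟫ - relu ⟪z.1, wstar⟫) * ⟪z.1, h⟫ - noise wstar z * ⟪z.1, h⟫) := by
  simp only [glmStep, noise, inner_sub_left, inner_smul_left, RCLike.conj_to_real]
  ring

/-- All terms linear in the noise vanish. The drift `2γ` is halved by `integral_relu_mul_inner`. -/
lemma integral_inner_glmStep_sq (hD : FourthMoment D) (hS : SymmetricFeatures D)
    (hW : WellSpecified D wstar) (γ : ℝ) (w h : E) :
    ∫ z, ⟪glmStep γ w z - wstar, h⟫ ^ 2 ∂D =
      ⟪w - wstar, h⟫ ^ 2 - γ * (⟪w - wstar, h⟫ * ⟪w - wstar, cov D h⟫) +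
      γ ^ 2 * (∫ z, (relu ⟪z.1, w⟫ - relu ⟪z.1, wstar⟫) ^ 2 * ⟪z.1, h⟫ ^ 2 ∂D +
        risk D wstar * ⟪h, cov D h⟫) := by
  set p : ℝ := ⟪w - wstar, h⟫ with hp
  set s : E × ℝ → ℝ := fun z => (relu ⟪z.1, w⟫ - relu ⟪z.1, wstar⟫) * ⟪z.1, h⟫ with hs
  set n : E × ℝ → ℝ := fun z => noise wstar z * ⟪z.1, h⟫ with hn
  have hsL : MemLp s 2 D := memLp_relu_sub_mul_inner hD w wstar h
  have hnL : MemLp n 2 D := hW.memLp_noise_mul_inner h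
  have hs1 : Integrable s D := hsL.integrable (by norm_num)
  have hn1 : Integrable n D := hnL.integrable (by norm_num)
  have hsn : Integrable (fun z => s z * n z) D := hsL.integrable_mul hnL
  have hs2 := hsL.integrable_sq
  have hn2 := hnL.integrable_sq
  have e1 : ∫ z, s z ∂D = 1 / 2 * ⟪w - wstar, cov D h⟫ := by
    have i1 : ∀ w : E, Integrable (fun z : E × ℝ => relu ⟪z.1, w⟫ * ⟪z.1, h⟫) D := fun w =>
      (memLp_relu hD w).integrable_mul (memLp_inner hD h)
    simp only [hs, sub_mul]
    rw [integral_sub (i1 _) (i1 _), integral_relu_mul_inner hS hD, integral_relu_mul_inner hS hD,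
      inner_sub_left]
    ring
  have e2 : ∫ z, n z ∂D = 0 := by
    have h1 := hW.integral_mul_noise hD (g := fun x => ⟪x, h⟫) (by fun_prop)
      (by simpa [hn, mul_comm] using hn1)
    simpa [hn, mul_comm] using h1
  have e3 : ∫ z, s z * n z ∂D = 0 := by
    have heq : ∀ z : E × ℝ, s z * n z =
        (relu ⟪z.1, w⟫ - relu ⟪z.1, wstar⟫) * ⟪z.1, h⟫ ^ 2 * noise wstar z := fun z => by
      simp only [hs, hn]; ring
    simp only [heq] at hsn ⊢
    exact hW.integral_mul_noise hD
      (g := fun x => (relu ⟪x, w⟫ - relu ⟪x, wstar⟫) * ⟪x, h⟫ ^ 2)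
      (((measurable_relu.comp (by fun_prop)).sub (measurable_relu.comp (by fun_prop))).mul
        (by fun_prop)) hsn
  have e4 : ∫ z, n z ^ 2 ∂D = risk D wstar * ⟪h, cov D h⟫ := by
    rw [← hW.integral_noise_sq_mul]
    simp only [hn, mul_pow]
  have e5 : ∫ z, s z ^ 2 ∂D =
      ∫ z, (relu ⟪z.1, w⟫ - relu ⟪z.1, wstar⟫) ^ 2 * ⟪z.1, h⟫ ^ 2 ∂D := by
    simp only [hs, mul_pow]
  have hexp : ∀ z, ⟪glmStep γ w z - wstar, h⟫ ^ 2 = p ^ 2 - 2 * γ * p * s z + 2 * γ * p * n z +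
      γ ^ 2 * s z ^ 2 - 2 * γ ^ 2 * (s z * n z) + γ ^ 2 * n z ^ 2 := fun z => by
    rw [inner_glmStep_sub]
    simp only [hs, hn, hp]
    ring
  simp only [hexp]
  have j1 : Integrable (fun z => p ^ 2 - 2 * γ * p * s z) D :=
    (integrable_const _).sub (hs1.const_mul _)
  have j2 : Integrable (fun z => p ^ 2 - 2 * γ * p * s z + 2 * γ * p * n z) D :=
    j1.add (hn1.const_mul _)
  have j3 : Integrable (fun z => p ^ 2 - 2 * γ * p * s z + 2 * γ * p * n z +
      γ ^ 2 * s z ^ 2) D := j2.add (hs2.const_mul _)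
  have j4 : Integrable (fun z => p ^ 2 - 2 * γ * p * s z + 2 * γ * p * n z +
      γ ^ 2 * s z ^ 2 - 2 * γ ^ 2 * (s z * n z)) D := j3.sub (hsn.const_mul _)
  rw [integral_add j4 (hn2.const_mul _), integral_sub j3 (hsn.const_mul _),
    integral_add j2 (hs2.const_mul _), integral_add j1 (hn1.const_mul _),
    integral_sub (integrable_const _) (hs1.const_mul _)]
  simp only [integral_const_mul, integral_const, probReal_univ, one_smul, e1, e2, e3, e4, e5]
  ring

variable {lam : ℕ → ℝ} {e : ℕ → E}

lemma integral_glmStep_eigen (hD : FourthMoment D) (hS : SymmetricFeatures D)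
    (hW : WellSpecified D wstar) (he : IsEigenDecomp (cov D) lam e) (γ : ℝ) (w : E) (i : ℕ) :
    ∫ z, ⟪glmStep γ w z - wstar, e i⟫ ^ 2 ∂D =
      (1 - γ * lam i) * ⟪w - wstar, e i⟫ ^ 2 +
      γ ^ 2 * (∫ z, (relu ⟪z.1, w⟫ - relu ⟪z.1, wstar⟫) ^ 2 * ⟪z.1, e i⟫ ^ 2 ∂D +
        risk D wstar * lam i) := by
  rw [integral_inner_glmStep_sq hD hS hW, inner_cov_comm hD, he.inner_apply, he.inner_apply,
    he.inner_self, real_inner_comm (w - wstar) (e i)]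
  ring

lemma integral_glmStep_eigen_le (hD : FourthMoment D) (hS : SymmetricFeatures D)
    (hW : WellSpecified D wstar) (he : IsEigenDecomp (cov D) lam e) {α : ℝ}
    (hα : UpperHypercontractive D α) (γ : ℝ) (w : E) (i : ℕ) :
    ∫ z, ⟪glmStep γ w z - wstar, e i⟫ ^ 2 ∂D ≤
      (1 - γ * lam i) * ⟪w - wstar, e i⟫ ^ 2 +
      γ ^ 2 * lam i * (α / 2 * ⟪w - wstar, cov D (w - wstar)⟫ + risk D wstar) := by
  rw [integral_glmStep_eigen hD hS hW he]
  have h1 := (integral_relu_sub_sq_mul_mem hS hD w wstar (e i)).2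
  have h2 := hα.fourth_le hD (w - wstar) (e i)
  rw [he.inner_apply, he.inner_self] at h2
  have h3 := mul_le_mul_of_nonneg_left (h1.trans (mul_le_mul_of_nonneg_left h2
    (by norm_num : (0 : ℝ) ≤ 1 / 2))) (sq_nonneg γ)
  linarith

/-- The term `HAH` of the assumption contributes `γ²λ²/4`, completing `1 - γλ` to the square `(1 -
γλ/2)²`. -/
lemma le_integral_glmStep_eigen (hD : FourthMoment D) (hS : SymmetricFeatures D)
    (hW : WellSpecified D wstar) (he : IsEigenDecomp (cov D) lam e) {β : ℝ}
    (hβ : LowerHypercontractive D β) (γ : ℝ) (w : E) (i : ℕ) :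
    (1 - γ / 2 * lam i) ^ 2 * ⟪w - wstar, e i⟫ ^ 2 +
      γ ^ 2 * lam i * (β / 4 * ⟪w - wstar, cov D (w - wstar)⟫ + risk D wstar) ≤
    ∫ z, ⟪glmStep γ w z - wstar, e i⟫ ^ 2 ∂D := by
  rw [integral_glmStep_eigen hD hS hW he]
  have h1 := (integral_relu_sub_sq_mul_mem hS hD w wstar (e i)).1
  have h2 := hβ.le_fourth hD (w - wstar) (e i)
  rw [inner_cov_comm hD (w - wstar) (e i), he.inner_apply, he.inner_apply, he.inner_self,
    real_inner_comm (w - wstar) (e i), mul_pow] at h2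
  have h3 := mul_le_mul_of_nonneg_left ((mul_le_mul_of_nonneg_left h2
    (by norm_num : (0 : ℝ) ≤ 1 / 4)).trans h1) (sq_nonneg γ)
  linarith

end OneStep

/-! ### Independence and integrability of the iterates. -/

section Iterates

variable {E : Type u} [NormedAddCommGroup E] [InnerProductSpace ℝ E]

lemma iterate_succ (γ : ℕ → ℝ) (w₀ : E) (z : ℕ → E × ℝ) (t : ℕ) :
    iterate γ w₀ z (t + 1) = glmStep (γ (t + 1)) (iterate γ w₀ z t) (z (t + 1)) := rfl

lemma iterate_congr {γ : ℕ → ℝ} {w₀ : E} {z z' : ℕ → E × ℝ} {t : ℕ}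
    (h : ∀ s, 1 ≤ s → s ≤ t → z s = z' s) : iterate γ w₀ z t = iterate γ w₀ z' t := by
  induction t with
  | zero => rfl
  | succ t ih =>
    rw [iterate_succ, iterate_succ, ih fun s h1 h2 => h s h1 (by omega),
      h (t + 1) (by omega) le_rfl]

variable [CompleteSpace E] [SecondCountableTopology E] [MeasurableSpace E] [BorelSpace E]

lemma measurable_glmStep (γ : ℝ) :
    Measurable fun p : E × (E × ℝ) => glmStep γ p.1 p.2 := by
  have h : Measurable fun p : E × (E × ℝ) => relu ⟪p.2.1, p.1⟫ :=
    measurable_relu.comp (by fun_prop)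
  unfold glmStep
  fun_prop

lemma measurable_iterate {β : Type*} [MeasurableSpace β] (γ : ℕ → ℝ) (w₀ : E)
    {z : β → ℕ → E × ℝ} (hz : ∀ s, Measurable fun b => z b s) (t : ℕ) :
    Measurable fun b => iterate γ w₀ (z b) t := by
  induction t with
  | zero => exact measurable_const
  | succ t ih => exact (measurable_glmStep (γ (t + 1))).comp (ih.prodMk (hz (t + 1)))

variable {D : Measure (E × ℝ)} [IsProbabilityMeasure D] {wstar : E}
  {Ω : Type v} [MeasurableSpace Ω] {P : Measure Ω} [IsProbabilityMeasure P]
  {N : ℕ} {Z : ℕ → Ω → E × ℝ} {γ : ℕ → ℝ} {w₀ : E}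

namespace IsSample

lemma aemeasurable_iterate (hZ : IsSample P D N Z) {t : ℕ} (ht : t ≤ N) :
    AEMeasurable (fun ω => iterate γ w₀ (fun s => Z s ω) t) P := by
  induction t with
  | zero => exact aemeasurable_const
  | succ t ih =>
    exact (measurable_glmStep (γ (t + 1))).comp_aemeasurable
      ((ih (by omega)).prodMk
        (hZ.law (t + 1) (Finset.mem_Icc.2 ⟨by omega, ht⟩)).aemeasurable)

lemma indepFun_iterate (hZ : IsSample P D N Z) {t : ℕ} (ht : t < N) :
    IndepFun (fun ω => iterate γ w₀ (fun s => Z s ω) t) (Z (t + 1)) P := by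
  classical
  set j : Finset.Icc 1 N := ⟨t + 1, Finset.mem_Icc.2 ⟨by omega, ht⟩⟩ with hj
  set S : Finset (Finset.Icc 1 N) := Finset.univ.filter fun i => i.1 ≤ t with hS
  have hdisj : Disjoint S {j} := by
    rw [Finset.disjoint_singleton_right, hS, Finset.mem_filter]
    rintro ⟨_, h⟩
    simp only [hj] at h
    omega
  have h1 := hZ.indep.indepFun_finset₀ S {j} hdisj fun i => (hZ.law i.1 i.2).aemeasurable
  have hmem : ∀ s, (h1 : 1 ≤ s) → (h2 : s ≤ t) →
      (⟨s, Finset.mem_Icc.2 ⟨h1, by omega⟩⟩ : Finset.Icc 1 N) ∈ S := fun s h1 h2 => by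
    simpa [hS] using h2
  -- Exhibits the iterate as a measurable function of the first `t` samples only; the filler `0` is
  -- never read, by `iterate_congr`.
  let ext : (S → E × ℝ) → ℕ → E × ℝ := fun p s =>
    if h : 1 ≤ s ∧ s ≤ t then p ⟨_, hmem s h.1 h.2⟩ else 0
  have hext : ∀ s, Measurable fun p => ext p s := fun s => by
    simp only [ext]
    split_ifs
    · exact measurable_pi_apply _
    · exact measurable_const
  have hψ : Measurable fun p : ({j} : Finset (Finset.Icc 1 N)) → E × ℝ =>
      p ⟨j, Finset.mem_singleton_self j⟩ := measurable_pi_apply _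
  have h2 := h1.comp (measurable_iterate γ w₀ hext t) hψ
  have h3 : (fun ω => iterate γ w₀ (fun s => Z s ω) t) =
      (fun p => iterate γ w₀ (ext p) t) ∘ fun ω (i : S) => Z i.1.1 ω := by
    funext ω
    refine iterate_congr fun s h1 h2 => ?_
    simp only [ext]
    rw [dif_pos ⟨h1, h2⟩]
  rw [h3]
  exact h2

lemma map_prodMk (hZ : IsSample P D N Z) {t : ℕ} (ht : t < N) :
    P.map (fun ω => (iterate γ w₀ (fun s => Z s ω) t, Z (t + 1) ω)) =
      (P.map fun ω => iterate γ w₀ (fun s => Z s ω) t).prod D := by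
  have hl := hZ.law (t + 1) (Finset.mem_Icc.2 ⟨by omega, ht⟩)
  rw [(indepFun_iff_map_prod_eq_prod_map_map (hZ.aemeasurable_iterate ht.le) hl.aemeasurable).1
    (hZ.indepFun_iterate ht), hl.map_eq]

lemma aemeasurable_prodMk (hZ : IsSample P D N Z) {t : ℕ} (ht : t < N) :
    AEMeasurable (fun ω => (iterate γ w₀ (fun s => Z s ω) t, Z (t + 1) ω)) P :=
  (hZ.aemeasurable_iterate ht.le).prodMk
    (hZ.law (t + 1) (Finset.mem_Icc.2 ⟨by omega, ht⟩)).aemeasurable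

/-- Integrating a function of the next iterate: first over the fresh sample, then over the past. -/
lemma integral_next (hZ : IsSample P D N Z) {t : ℕ} (ht : t < N) {F : E → ℝ}
    (hF : Measurable F)
    (hint : Integrable (fun ω => F (iterate γ w₀ (fun s => Z s ω) (t + 1))) P) :
    Integrable (fun ω => ∫ z, F (glmStep (γ (t + 1)) (iterate γ w₀ (fun s => Z s ω) t) z) ∂D) P ∧
    ∫ ω, F (iterate γ w₀ (fun s => Z s ω) (t + 1)) ∂P =
      ∫ ω, ∫ z, F (glmStep (γ (t + 1)) (iterate γ w₀ (fun s => Z s ω) t) z) ∂D ∂P := by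
  have hm := hZ.aemeasurable_prodMk (γ := γ) (w₀ := w₀) ht
  have hW := hZ.aemeasurable_iterate (γ := γ) (w₀ := w₀) ht.le
  have hG : Measurable fun p : E × (E × ℝ) => F (glmStep (γ (t + 1)) p.1 p.2) :=
    hF.comp (measurable_glmStep _)
  have := Measure.isProbabilityMeasure_map (μ := P) hW
  have h1 : Integrable (fun p : E × (E × ℝ) => F (glmStep (γ (t + 1)) p.1 p.2))
      ((P.map fun ω => iterate γ w₀ (fun s => Z s ω) t).prod D) := by
    rw [← hZ.map_prodMk ht]
    exact (integrable_map_measure hG.aestronglyMeasurable hm).2 hint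
  have h2 := h1.integral_prod_left
  constructor
  · exact (integrable_map_measure h2.aestronglyMeasurable hW).1 h2
  · rw [← integral_map hW h2.aestronglyMeasurable, ← integral_prod _ h1, ← hZ.map_prodMk ht,
      integral_map hm hG.aestronglyMeasurable]
    rfl

end IsSample

lemma norm_glmStep_sub_le (γ : ℝ) (wstar w : E) (z : E × ℝ) :
    ‖glmStep γ w z - wstar‖ ≤
      ‖w - wstar‖ * (1 + |γ| * ‖z.1‖ ^ 2) + |γ| * |noise wstar z| * ‖z.1‖ := by
  have h1 : glmStep γ w z - wstar = (w - wstar) -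
      (γ * ((relu ⟪z.1, w⟫ - relu ⟪z.1, wstar⟫) - noise wstar z)) • z.1 := by
    simp only [glmStep, noise]
    rw [show relu ⟪z.1, w⟫ - relu ⟪z.1, wstar⟫ - (z.2 - relu ⟪z.1, wstar⟫) =
      relu ⟪z.1, w⟫ - z.2 by ring]
    abel
  rw [h1]
  refine (norm_sub_le _ _).trans ?_
  rw [norm_smul, Real.norm_eq_abs, abs_mul]
  have h2 : |relu ⟪z.1, w⟫ - relu ⟪z.1, wstar⟫ - noise wstar z| ≤
      ‖w - wstar‖ * ‖z.1‖ + |noise wstar z| :=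
    (abs_sub _ _).trans (by linarith [abs_relu_inner_sub_le z.1 w wstar])
  have h3 := mul_le_mul_of_nonneg_right (mul_le_mul_of_nonneg_left h2 (abs_nonneg γ))
    (norm_nonneg z.1)
  linarith

/-- By induction: the next squared error is dominated by the current one times an independent
factor, integrable by the fourth moment, plus a multiple of `ε²‖x‖²`. -/
lemma integrable_norm_sq_iterate (hD : FourthMoment D) (hW : WellSpecified D wstar)
    (hZ : IsSample P D N Z) {t : ℕ} (ht : t ≤ N) :
    Integrable (fun ω => ‖iterate γ w₀ (fun s => Z s ω) t - wstar‖ ^ 2) P := by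
  induction t with
  | zero => exact integrable_const (μ := P) (‖w₀ - wstar‖ ^ 2)
  | succ t ih =>
    have hm := hZ.aemeasurable_prodMk (γ := γ) (w₀ := w₀) (t := t) (by omega)
    have hWm := hZ.aemeasurable_iterate (γ := γ) (w₀ := w₀) (t := t) (by omega)
    have := Measure.isProbabilityMeasure_map (μ := P) hWm
    have hn : Measurable fun w : E => ‖w - wstar‖ ^ 2 := by fun_prop
    have h1 : Integrable (fun w : E => ‖w - wstar‖ ^ 2)
        (P.map fun ω => iterate γ w₀ (fun s => Z s ω) t) :=
      (integrable_map_measure hn.aestronglyMeasurable hWm).2 (ih (by omega))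
    have h2 : Integrable (fun z : E × ℝ => 2 * (1 + |γ (t + 1)| * ‖z.1‖ ^ 2) ^ 2) D := by
      have h3 : Integrable (fun z : E × ℝ => 2 + 4 * |γ (t + 1)| * ‖z.1‖ ^ 2 +
          2 * |γ (t + 1)| ^ 2 * ‖z.1‖ ^ 4) D :=
        ((integrable_const _).add (hD.integrable_two.const_mul _)).add
          (hD.integrable_four.const_mul _)
      refine h3.congr (ae_of_all _ fun z => ?_)
      simp only
      ring
    have h3 : Integrable (fun z : E × ℝ =>
        2 * |γ (t + 1)| ^ 2 * (noise wstar z ^ 2 * ‖z.1‖ ^ 2)) D :=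
      hW.integrable_noise.const_mul _
    have h4 := (h1.mul_prod h2).add
      (h3.comp_snd (P.map fun ω => iterate γ w₀ (fun s => Z s ω) t))
    have hG : Measurable fun p : E × (E × ℝ) => ‖glmStep (γ (t + 1)) p.1 p.2 - wstar‖ ^ 2 :=
      hn.comp (measurable_glmStep _)
    have h5 : Integrable (fun p : E × (E × ℝ) => ‖glmStep (γ (t + 1)) p.1 p.2 - wstar‖ ^ 2)
        ((P.map fun ω => iterate γ w₀ (fun s => Z s ω) t).prod D) := by
      refine h4.mono' hG.aestronglyMeasurable (ae_of_all _ fun p => ?_)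
      rw [Real.norm_of_nonneg (by positivity)]
      refine (pow_le_pow_left₀ (norm_nonneg _) (norm_glmStep_sub_le _ wstar p.1 p.2) 2).trans ?_
      refine add_sq_le.trans (le_of_eq ?_)
      simp only [Pi.add_apply]
      rw [← sq_abs (noise wstar p.2)]
      ring
    rw [← hZ.map_prodMk (by omega)] at h5
    exact (integrable_map_measure hG.aestronglyMeasurable hm).1 h5

end Iterates

/-! ### Recursions for the expected squared errors. -/

section Expectation

variable {E : Type u} [NormedAddCommGroup E] [InnerProductSpace ℝ E] [CompleteSpace E]
  [SecondCountableTopology E] [MeasurableSpace E] [BorelSpace E]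
  {D : Measure (E × ℝ)} [IsProbabilityMeasure D] {wstar : E}
  {Ω : Type v} [MeasurableSpace Ω] {P : Measure Ω} [IsProbabilityMeasure P]
  {N : ℕ} {Z : ℕ → Ω → E × ℝ} {γ : ℕ → ℝ} {w₀ : E} {lam : ℕ → ℝ} {e : ℕ → E}

/-- The second moment of the error of the `t`-th iterate along the direction `h`. -/
noncomputable def errSq (P : Measure Ω) (Z : ℕ → Ω → E × ℝ) (γ : ℕ → ℝ) (w₀ wstar : E) (t : ℕ)
    (h : E) : ℝ :=
  ∫ ω, ⟪iterate γ w₀ (fun s => Z s ω) t - wstar, h⟫ ^ 2 ∂P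

lemma errSq_nonneg (t : ℕ) (h : E) : 0 ≤ errSq P Z γ w₀ wstar t h :=
  integral_nonneg fun _ => sq_nonneg _

lemma errSq_zero (h : E) : errSq P Z γ w₀ wstar 0 h = ⟪h, w₀ - wstar⟫ ^ 2 := by
  simp [errSq, iterate, real_inner_comm]

lemma inner_sq_le (x h : E) : ⟪x, h⟫ ^ 2 ≤ ‖h‖ ^ 2 * ‖x‖ ^ 2 := by
  rw [← sq_abs, ← mul_pow, mul_comm]
  exact pow_le_pow_left₀ (abs_nonneg _) (abs_real_inner_le_norm _ _) 2

lemma integrable_inner_sq_iterate (hD : FourthMoment D) (hW : WellSpecified D wstar)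
    (hZ : IsSample P D N Z) {t : ℕ} (ht : t ≤ N) (h : E) :
    Integrable (fun ω => ⟪iterate γ w₀ (fun s => Z s ω) t - wstar, h⟫ ^ 2) P := by
  have hm : Measurable fun w : E => ⟪w - wstar, h⟫ ^ 2 := by fun_prop
  refine ((integrable_norm_sq_iterate hD hW hZ ht (γ := γ) (w₀ := w₀)).const_mul (‖h‖ ^ 2)).mono'
    (hm.comp_aemeasurable (hZ.aemeasurable_iterate ht)).aestronglyMeasurable
    (ae_of_all _ fun ω => ?_)
  rw [Real.norm_of_nonneg (sq_nonneg _)]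
  exact inner_sq_le _ _

lemma integrable_inner_cov_iterate (hD : FourthMoment D) (hW : WellSpecified D wstar)
    (hZ : IsSample P D N Z) {t : ℕ} (ht : t ≤ N) :
    Integrable (fun ω => ⟪iterate γ w₀ (fun s => Z s ω) t - wstar,
      cov D (iterate γ w₀ (fun s => Z s ω) t - wstar)⟫) P := by
  have hm : Measurable fun w : E => ⟪w - wstar, cov D (w - wstar)⟫ := by fun_prop
  refine ((integrable_norm_sq_iterate hD hW hZ ht (γ := γ) (w₀ := w₀)).const_mul ‖cov D‖).mono'
    (hm.comp_aemeasurable (hZ.aemeasurable_iterate ht)).aestronglyMeasurable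
    (ae_of_all _ fun ω => ?_)
  set x := iterate γ w₀ (fun s => Z s ω) t - wstar
  calc ‖⟪x, cov D x⟫‖ ≤ ‖x‖ * ‖cov D x‖ := norm_inner_le_norm _ _
    _ ≤ ‖x‖ * (‖cov D‖ * ‖x‖) :=
      mul_le_mul_of_nonneg_left ((cov D).le_opNorm x) (norm_nonneg _)
    _ = _ := by ring

lemma hasSum_errSq (hD : FourthMoment D) (hW : WellSpecified D wstar)
    (he : IsEigenDecomp (cov D) lam e) (hZ : IsSample P D N Z) {t : ℕ} (ht : t ≤ N) :
    HasSum (fun i => lam i * errSq P Z γ w₀ wstar t (e i))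
      (∫ ω, ⟪iterate γ w₀ (fun s => Z s ω) t - wstar,
        cov D (iterate γ w₀ (fun s => Z s ω) t - wstar)⟫ ∂P) := by
  set x : Ω → E := fun ω => iterate γ w₀ (fun s => Z s ω) t - wstar with hx
  have hi := fun h => integrable_inner_sq_iterate (γ := γ) (w₀ := w₀) hD hW hZ ht h
  have hn := integrable_norm_sq_iterate (γ := γ) (w₀ := w₀) hD hW hZ ht
  have h1 : ∀ i, Integrable (fun ω => lam i * ⟪x ω, e i⟫ ^ 2) P := fun i =>
    (hi (e i)).const_mul _
  have h2 : Summable fun i => ∫ ω, ‖lam i * ⟪x ω, e i⟫ ^ 2‖ ∂P := by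
    refine Summable.of_nonneg_of_le (fun i => integral_nonneg fun ω => norm_nonneg _)
      (fun i => ?_) ((he.summable_lam hD).mul_right (∫ ω, ‖x ω‖ ^ 2 ∂P))
    rw [← integral_const_mul]
    refine integral_mono (h1 i).norm (hn.const_mul _) fun ω => ?_
    simp only
    rw [Real.norm_of_nonneg (mul_nonneg (he.nonneg i) (sq_nonneg _))]
    refine mul_le_mul_of_nonneg_left ((inner_sq_le _ _).trans ?_) (he.nonneg i)
    refine mul_le_of_le_one_left (sq_nonneg _) ?_
    rcases he.unit_or_pad i with h | ⟨h, _⟩ <;> simp [h]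
  have h3 := hasSum_integral_of_summable_integral_norm h1 h2
  simp only [integral_const_mul] at h3
  have h4 : ∫ ω, ⟪x ω, cov D (x ω)⟫ ∂P = ∫ ω, ∑' i, lam i * ⟪x ω, e i⟫ ^ 2 ∂P := by
    refine integral_congr_ae (ae_of_all _ fun ω => ?_)
    simp only
    rw [← (he.hasSum_inner_self (x ω)).tsum_eq]
    simp only [real_inner_comm]
  rw [h4]
  exact h3

lemma errSq_succ_le (hD : FourthMoment D) (hS : SymmetricFeatures D) (hW : WellSpecified D wstar)
    (he : IsEigenDecomp (cov D) lam e) (hZ : IsSample P D N Z) {α : ℝ}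
    (hα : UpperHypercontractive D α) {t : ℕ} (ht : t < N) (i : ℕ) :
    errSq P Z γ w₀ wstar (t + 1) (e i) ≤ (1 - γ (t + 1) * lam i) * errSq P Z γ w₀ wstar t (e i) +
      γ (t + 1) ^ 2 * lam i *
        (α / 2 * (∑' j, lam j * errSq P Z γ w₀ wstar t (e j)) + risk D wstar) := by
  obtain ⟨h1, h2⟩ := hZ.integral_next ht (F := fun w => ⟪w - wstar, e i⟫ ^ 2) (by fun_prop)
    (integrable_inner_sq_iterate (γ := γ) (w₀ := w₀) hD hW hZ ht (e i))
  have i1 := integrable_inner_sq_iterate (γ := γ) (w₀ := w₀) hD hW hZ ht.le (e i)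
  have i2 := integrable_inner_cov_iterate (γ := γ) (w₀ := w₀) hD hW hZ ht.le
  rw [(hasSum_errSq hD hW he hZ ht.le).tsum_eq]
  simp only [errSq] at h2 ⊢
  rw [h2, ← integral_const_mul, ← integral_const_mul]
  have i3 : Integrable (fun ω => α / 2 * ⟪iterate γ w₀ (fun s => Z s ω) t - wstar,
      cov D (iterate γ w₀ (fun s => Z s ω) t - wstar)⟫ + risk D wstar) P :=
    (i2.const_mul _).add (integrable_const _)
  have h3 : ∫ ω, α / 2 * ⟪iterate γ w₀ (fun s => Z s ω) t - wstar,
      cov D (iterate γ w₀ (fun s => Z s ω) t - wstar)⟫ ∂P + risk D wstar =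
      ∫ ω, (α / 2 * ⟪iterate γ w₀ (fun s => Z s ω) t - wstar,
      cov D (iterate γ w₀ (fun s => Z s ω) t - wstar)⟫ + risk D wstar) ∂P := by
    rw [integral_add (i2.const_mul _) (integrable_const _)]
    simp
  rw [h3, ← integral_const_mul, ← integral_add (i1.const_mul _) (i3.const_mul _)]
  exact integral_mono h1 ((i1.const_mul _).add (i3.const_mul _)) fun ω =>
    integral_glmStep_eigen_le hD hS hW he hα _ _ i

lemma le_errSq_succ (hD : FourthMoment D) (hS : SymmetricFeatures D) (hW : WellSpecified D wstar)
    (he : IsEigenDecomp (cov D) lam e) (hZ : IsSample P D N Z) {β : ℝ}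
    (hβ : LowerHypercontractive D β) {t : ℕ} (ht : t < N) (i : ℕ) :
    (1 - γ (t + 1) / 2 * lam i) ^ 2 * errSq P Z γ w₀ wstar t (e i) +
      γ (t + 1) ^ 2 * lam i *
        (β / 4 * (∑' j, lam j * errSq P Z γ w₀ wstar t (e j)) + risk D wstar) ≤
    errSq P Z γ w₀ wstar (t + 1) (e i) := by
  obtain ⟨h1, h2⟩ := hZ.integral_next ht (F := fun w => ⟪w - wstar, e i⟫ ^ 2) (by fun_prop)
    (integrable_inner_sq_iterate (γ := γ) (w₀ := w₀) hD hW hZ ht (e i))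
  have i1 := integrable_inner_sq_iterate (γ := γ) (w₀ := w₀) hD hW hZ ht.le (e i)
  have i2 := integrable_inner_cov_iterate (γ := γ) (w₀ := w₀) hD hW hZ ht.le
  rw [(hasSum_errSq hD hW he hZ ht.le).tsum_eq]
  simp only [errSq] at h2 ⊢
  rw [h2, ← integral_const_mul, ← integral_const_mul]
  have i3 : Integrable (fun ω => β / 4 * ⟪iterate γ w₀ (fun s => Z s ω) t - wstar,
      cov D (iterate γ w₀ (fun s => Z s ω) t - wstar)⟫ + risk D wstar) P :=
    (i2.const_mul _).add (integrable_const _)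
  have h3 : ∫ ω, β / 4 * ⟪iterate γ w₀ (fun s => Z s ω) t - wstar,
      cov D (iterate γ w₀ (fun s => Z s ω) t - wstar)⟫ ∂P + risk D wstar =
      ∫ ω, (β / 4 * ⟪iterate γ w₀ (fun s => Z s ω) t - wstar,
      cov D (iterate γ w₀ (fun s => Z s ω) t - wstar)⟫ + risk D wstar) ∂P := by
    rw [integral_add (i2.const_mul _) (integrable_const _)]
    simp
  rw [h3, ← integral_const_mul, ← integral_add (i1.const_mul _) (i3.const_mul _)]
  exact integral_mono ((i1.const_mul _).add (i3.const_mul _)) h1 fun ω =>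
    le_integral_glmStep_eigen hD hS hW he hβ _ _ i

lemma measurable_excessRisk (hD : FourthMoment D) (hW : WellSpecified D wstar) :
    Measurable (excessRisk D wstar) := by
  have h : Measurable (Function.uncurry fun (w : E) (z : E × ℝ) =>
      (relu ⟪z.1, w⟫ - relu ⟪z.1, wstar⟫) ^ 2) := by
    have h1 : Measurable fun p : E × (E × ℝ) => relu ⟪p.2.1, p.1⟫ :=
      measurable_relu.comp (by fun_prop)
    have h2 : Measurable fun p : E × (E × ℝ) => relu ⟪p.2.1, wstar⟫ :=
      measurable_relu.comp (by fun_prop)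
    exact (h1.sub h2).pow_const 2
  have h3 := (h.stronglyMeasurable.integral_prod_right (ν := D)).measurable
  convert h3 using 1
  funext w
  exact hW.excessRisk_eq hD w

/-- The expected excess risk is comparable to the weighted sum of the directional errors. -/
lemma excessRisk_iterate_bounds (hD : FourthMoment D) (hS : SymmetricFeatures D)
    (hW : WellSpecified D wstar) (he : IsEigenDecomp (cov D) lam e) (hZ : IsSample P D N Z)
    {t : ℕ} (ht : t ≤ N) :
    Integrable (fun ω => excessRisk D wstar (iterate γ w₀ (fun s => Z s ω) t)) P ∧
    1 / 4 * ∑' i, lam i * errSq P Z γ w₀ wstar t (e i) ≤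
      ∫ ω, excessRisk D wstar (iterate γ w₀ (fun s => Z s ω) t) ∂P ∧
    ∫ ω, excessRisk D wstar (iterate γ w₀ (fun s => Z s ω) t) ∂P ≤
      1 / 2 * ∑' i, lam i * errSq P Z γ w₀ wstar t (e i) := by
  have i2 := integrable_inner_cov_iterate (γ := γ) (w₀ := w₀) hD hW hZ ht
  have hb : ∀ w, 1 / 4 * ⟪w - wstar, cov D (w - wstar)⟫ ≤ excessRisk D wstar w ∧
      excessRisk D wstar w ≤ 1 / 2 * ⟪w - wstar, cov D (w - wstar)⟫ := fun w => by
    rw [hW.excessRisk_eq hD]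
    exact integral_relu_sub_sq_mem hS hD w wstar
  have hint : Integrable (fun ω => excessRisk D wstar (iterate γ w₀ (fun s => Z s ω) t)) P := by
    refine (i2.const_mul (1 / 2)).mono' ((measurable_excessRisk hD hW).comp_aemeasurable
      (hZ.aemeasurable_iterate ht)).aestronglyMeasurable (ae_of_all _ fun ω => ?_)
    have h1 := hb (iterate γ w₀ (fun s => Z s ω) t)
    have h2 := inner_cov_self_nonneg hD (iterate γ w₀ (fun s => Z s ω) t - wstar)
    rw [Real.norm_of_nonneg (by linarith)]
    exact h1.2
  rw [(hasSum_errSq hD hW he hZ ht).tsum_eq, ← integral_const_mul, ← integral_const_mul]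
  exact ⟨hint, integral_mono (i2.const_mul _) hint fun ω => (hb _).1,
    integral_mono hint (i2.const_mul _) fun ω => (hb _).2⟩

/-- A nonzero eigenvalue forces the hypercontractivity constant to be at least one. -/
lemma UpperHypercontractive.lam_le (hD : FourthMoment D) (he : IsEigenDecomp (cov D) lam e)
    {α : ℝ} (hα : UpperHypercontractive D α) (i : ℕ) : lam i ≤ α * lam i := by
  have h1 := hα.fourth_le hD (e i) (e i)
  have h2 : lam i = ∫ z, ⟪z.1, e i⟫ ^ 2 ∂D := by
    rw [← inner_cov_self hD, he.inner_apply, he.inner_self]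
  rw [he.inner_apply, he.inner_self] at h1
  have i1 : Integrable (fun z : E × ℝ => ⟪z.1, e i⟫ ^ 2) D := (memLp_inner hD (e i)).integrable_sq
  have i2 : Integrable (fun z : E × ℝ => ⟪z.1, e i⟫ ^ 2 * ⟪z.1, e i⟫ ^ 2) D := by
    have := integrable_mul_inner_mul_inner (D := D) (f := fun z => ⟪z.1, e i⟫ ^ 2)
      ((measurable_inner_fst (e i)).pow_const 2).aestronglyMeasurable
      (hD.integrable_sq_mul (e i)) (e i) (e i)
    simpa [sq] using this
  -- The variance of `⟪x, e i⟫²` is nonnegative, so its second moment is at least `λ_i²`.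
  have h3 : 0 ≤ ∫ z, (⟪z.1, e i⟫ ^ 2 * ⟪z.1, e i⟫ ^ 2 - 2 * lam i * ⟪z.1, e i⟫ ^ 2 +
      lam i ^ 2) ∂D := integral_nonneg fun z => by
    have := sq_nonneg (⟪z.1, e i⟫ ^ 2 - lam i)
    simp only [Pi.zero_apply]
    nlinarith
  have i3 : Integrable (fun z : E × ℝ => ⟪z.1, e i⟫ ^ 2 * ⟪z.1, e i⟫ ^ 2 -
      2 * lam i * ⟪z.1, e i⟫ ^ 2) D := i2.sub (i1.const_mul _)
  rw [integral_add i3 (integrable_const _), integral_sub i2 (i1.const_mul _), integral_const_mul,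
    ← h2, integral_const, probReal_univ, one_smul] at h3
  rcases (he.nonneg i).eq_or_lt with h | h
  · rw [← h, mul_zero]
  · have h4 : lam i * lam i ≤ α * lam i * lam i := by nlinarith
    exact le_of_mul_le_mul_right h4 h

end Expectation

/-! ### Assembly of both bounds. -/

section Main

variable {E : Type u} [NormedAddCommGroup E] [InnerProductSpace ℝ E] [CompleteSpace E]
  [SecondCountableTopology E] [MeasurableSpace E] [BorelSpace E]
  {D : Measure (E × ℝ)} [IsProbabilityMeasure D] {wstar : E}
  {Ω : Type v} [MeasurableSpace Ω] {P : Measure Ω} [IsProbabilityMeasure P]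
  {N : ℕ} {Z : ℕ → Ω → E × ℝ} {w₀ : E} {lam : ℕ → ℝ} {e : ℕ → E}

lemma tsum_errSq_le (hD : FourthMoment D) (hS : SymmetricFeatures D) (hW : WellSpecified D wstar)
    (he : IsEigenDecomp (cov D) lam e) (hN : 100 < N) (hZ : IsSample P D N Z) {γ₀ α : ℝ}
    (hα : 0 < α) (hH : UpperHypercontractive D α) (hγ : 0 < γ₀)
    (htr : γ₀ * (4 * α * opTrace (cov D)) < 1) (k : ℕ) :
    ∑' i, lam i * errSq P Z (stepsize γ₀ N) w₀ wstar N (e i) ≤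
      480 * (wnormSq (cov D) (biasOp (cov D) (stepsize γ₀ N) N (w₀ - wstar)) +
        (α * wnormSq ((1 / (Neff N * γ₀)) • headProj e k + tailOp lam e k) (w₀ - wstar) +
          risk D wstar) * (Deff lam γ₀ N k / Neff N)) := by
  have hsum := he.summable_lam hD
  rw [he.opTrace_eq hsum] at htr
  -- The trace condition yields this because `λ_i ≤ α λ_i ≤ α tr H`.
  have hγl : ∀ i, γ₀ * lam i ≤ 1 / 4 := fun i => by
    have h1 := hH.lam_le hD he i
    have h2 : lam i ≤ ∑' j, lam j := hsum.le_tsum i fun j _ => he.nonneg j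
    have h3 := mul_le_mul_of_nonneg_left (h1.trans (mul_le_mul_of_nonneg_left h2 hα.le)) hγ.le
    linarith
  have h := upper_of_recursion (a := fun t i => errSq P Z (stepsize γ₀ N) w₀ wstar t (e i)) hN hγ
    hα (WellSpecified.risk_nonneg (D := D) (wstar := wstar)) he.nonneg hsum hγl htr.le
    (fun t i => errSq_nonneg t (e i)) (fun t ht => (hasSum_errSq hD hW he hZ ht).summable)
    (fun t ht i => errSq_succ_le hD hS hW he hZ hH ht i) k
  simp only [errSq_zero] at h
  rwa [he.wnormSq_biasOp, he.wnormSq_headProj_add_tailOp]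

lemma le_tsum_errSq (hD : FourthMoment D) (hS : SymmetricFeatures D) (hW : WellSpecified D wstar)
    (he : IsEigenDecomp (cov D) lam e) (hN : 100 < N) (hZ : IsSample P D N Z) {γ₀ β : ℝ}
    (hβ : 0 < β) (hH : LowerHypercontractive D β) (hγ : 0 < γ₀) (hγl : γ₀ * lam 0 < 1) :
    Real.exp (-16) / 16 * (wnormSq (cov D) (biasOp (cov D) (stepsize γ₀ N) N (w₀ - wstar)) +
        (β * wnormSq (tailOp lam e (kStar lam γ₀ N)) (w₀ - wstar) + risk D wstar) *
          (Deff lam γ₀ N (kStar lam γ₀ N) / Neff N)) ≤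
      ∑' i, lam i * errSq P Z (stepsize γ₀ N) w₀ wstar N (e i) := by
  have h := lower_of_recursion (a := fun t i => errSq P Z (stepsize γ₀ N) w₀ wstar t (e i)) hN hγ
    hβ (WellSpecified.risk_nonneg (D := D) (wstar := wstar)) he.nonneg (he.summable_lam hD)
    he.antitone hγl (fun t i => errSq_nonneg t (e i))
    (fun t ht => (hasSum_errSq hD hW he hZ ht).summable)
    (fun t ht i => le_errSq_succ hD hS hW he hZ hH ht i)
  simp only [errSq_zero] at h
  rwa [he.wnormSq_biasOp, he.wnormSq_tailOp]

end Main

end GLMTron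

theorem mainTheorem1 :
    -- upper bound, with an absolute constant
    (∃ C : ℝ, 0 < C ∧
      ∀ (E : Type u) [NormedAddCommGroup E] [InnerProductSpace ℝ E] [CompleteSpace E]
        [SecondCountableTopology E] [MeasurableSpace E] [BorelSpace E]
        (D : Measure (E × ℝ)) [IsProbabilityMeasure D] (wstar : E)
        (lam : ℕ → ℝ) (e : ℕ → E)
        (Ω : Type v) [MeasurableSpace Ω] (P : Measure Ω) [IsProbabilityMeasure P]
        (N : ℕ) (Z : ℕ → Ω → E × ℝ) (w₀ : E) (γ₀ α : ℝ) (k : ℕ),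
        GLMTron.FourthMoment D →
        GLMTron.SymmetricFeatures D →
        GLMTron.WellSpecified D wstar →
        GLMTron.IsEigenDecomp (GLMTron.cov D) lam e →
        100 < N →
        GLMTron.IsSample P D N Z →
        0 < α → GLMTron.UpperHypercontractive D α →
        0 < γ₀ → γ₀ * (4 * α * GLMTron.opTrace (GLMTron.cov D)) < 1 →
        Integrable (fun ω => GLMTron.excessRisk D wstar
          (GLMTron.iterate (GLMTron.stepsize γ₀ N) w₀ (fun t => Z t ω) N)) P ∧
        ∫ ω, GLMTron.excessRisk D wstar
          (GLMTron.iterate (GLMTron.stepsize γ₀ N) w₀ (fun t => Z t ω) N) ∂P ≤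
          C * (GLMTron.wnormSq (GLMTron.cov D)
                (GLMTron.biasOp (GLMTron.cov D) (GLMTron.stepsize γ₀ N) N (w₀ - wstar)) +
              (α * GLMTron.wnormSq
                    ((1 / (GLMTron.Neff N * γ₀)) • GLMTron.headProj e k + GLMTron.tailOp lam e k)
                    (w₀ - wstar) +
                  GLMTron.risk D wstar) *
                (GLMTron.Deff lam γ₀ N k / GLMTron.Neff N))) ∧
    -- lower bound, with an absolute constant
    (∃ c : ℝ, 0 < c ∧
      ∀ (E : Type u) [NormedAddCommGroup E] [InnerProductSpace ℝ E] [CompleteSpace E]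
        [SecondCountableTopology E] [MeasurableSpace E] [BorelSpace E]
        (D : Measure (E × ℝ)) [IsProbabilityMeasure D] (wstar : E)
        (lam : ℕ → ℝ) (e : ℕ → E)
        (Ω : Type v) [MeasurableSpace Ω] (P : Measure Ω) [IsProbabilityMeasure P]
        (N : ℕ) (Z : ℕ → Ω → E × ℝ) (w₀ : E) (γ₀ β : ℝ),
        GLMTron.FourthMoment D →
        GLMTron.SymmetricFeatures D →
        GLMTron.WellSpecified D wstar →
        GLMTron.IsEigenDecomp (GLMTron.cov D) lam e →
        100 < N →
        GLMTron.IsSample P D N Z →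
        0 < β → GLMTron.LowerHypercontractive D β →
        0 < γ₀ → γ₀ * lam 0 < 1 →
        Integrable (fun ω => GLMTron.excessRisk D wstar
          (GLMTron.iterate (GLMTron.stepsize γ₀ N) w₀ (fun t => Z t ω) N)) P ∧
        c * (GLMTron.wnormSq (GLMTron.cov D)
                (GLMTron.biasOp (GLMTron.cov D) (GLMTron.stepsize γ₀ N) N (w₀ - wstar)) +
              (β * GLMTron.wnormSq
                    (GLMTron.tailOp lam e (GLMTron.kStar lam γ₀ N)) (w₀ - wstar) +
                  GLMTron.risk D wstar) *
                (GLMTron.Deff lam γ₀ N (GLMTron.kStar lam γ₀ N) / GLMTron.Neff N)) ≤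
          ∫ ω, GLMTron.excessRisk D wstar
            (GLMTron.iterate (GLMTron.stepsize γ₀ N) w₀ (fun t => Z t ω) N) ∂P) := by
  -- The constants `480` and `exp (-16) / 16` of the recursions are multiplied by the factors `1/2`
  -- and `1/4` that compare the excess risk with `‖w - w*‖²_H`.
  refine ⟨⟨240, by norm_num, ?_⟩, ⟨Real.exp (-16) / 64, by positivity, ?_⟩⟩
  · intro E _ _ _ _ _ _ D _ wstar lam e Ω _ P _ N Z w₀ γ₀ α k hD hS hW he hN hZ hα hH hγ htr
    obtain ⟨h1, -, h3⟩ := GLMTron.excessRisk_iterate_bounds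
      (γ := GLMTron.stepsize γ₀ N) (w₀ := w₀) hD hS hW he hZ le_rfl
    have h4 := GLMTron.tsum_errSq_le (w₀ := w₀) hD hS hW he hN hZ hα hH hγ htr k
    exact ⟨h1, by linarith⟩
  · intro E _ _ _ _ _ _ D _ wstar lam e Ω _ P _ N Z w₀ γ₀ β hD hS hW he hN hZ hβ hH hγ hγl
    obtain ⟨h1, h2, -⟩ := GLMTron.excessRisk_iterate_bounds
      (γ := GLMTron.stepsize γ₀ N) (w₀ := w₀) hD hS hW he hZ le_rfl
    have h4 := GLMTron.le_tsum_errSq (w₀ := w₀) hD hS hW he hN hZ hβ hH hγ hγl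
    exact ⟨h1, by linarith⟩
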